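/- For $|q|<1$ write $(a;q)_\infty=\prod_{k\ge 0}(1-aq^k)$, $(a_1,\dots,a_r;q)_\infty=\prod_{i}(a_i;q)_\infty$ and $E_j=(q^j;q^j)_\infty$, and let $$f(a,b)=\sum_{k=-\infty}^{\infty}a^{k(k+1)/2}b^{k(k-1)/2},\qquad \varphi(q)=f(q,q),\qquad \psi(q)=f(q,q^3).$$ For coprime integers $1\le j\le p-1$ define the integers $a_{j,p}(n)$ by the expansion, in powers of $q$, of Chan's Appell–Lerch sum $$\sum_{n=0}^{\infty} a_{j,p}(n)q^n = \frac{1}{(q^j, q^{p-j}, q^p; q^p)_{\infty}} \sum_{n=-\infty}^{\infty} \frac{(-1)^n q^{pn(n+1)/2+jn+j}}{1 - q^{pn+j}}.$$ Then, for every integer $n\ge 0$, $$a_{1,10}(10n+5)\equiv 0 \pmod 5 .$$ Moreover, the odd-indexed coefficients have the generating function $$2\sum_{n=0}^{\infty}a_{1,10}(2n+1)q^n=\frac{E_1^2}{E_5}+6q\,\frac{E_2E_{10}^3}{E_1E_5^2}+\frac{E_2^2}{E_1^2E_5}\Bigl(\varphi(q^2)\varphi(q^{10})-4q^3\psi(q^4)\psi(q^{20})\Bigr).$$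 -/

import Mathlib

open PowerSeries
open scoped PowerSeries.WithPiTopology

/-! All series are formal series in `q = X` with integer coefficients; infinite products and sums
of power series converge coefficientwise (`ℤ` is discrete). Division is multiplication by
`Ring.inverse`, which is the genuine inverse of every unit. -/

noncomputable section

/-- `(a; q)_∞ = ∏_{k ≥ 0} (1 - a q^k)`. -/
def qPoch (a q : ℤ⟦X⟧) : ℤ⟦X⟧ := ∏' k : ℕ, (1 - a * q ^ k)

/-- `E_j = (q^j; q^j)_∞`. -/
def eulerE (j : ℕ) : ℤ⟦X⟧ := qPoch (X ^ j) (X ^ j)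

/-- Ramanujan's general theta function `f(a, b) = ∑_{k ∈ ℤ} a^{k(k+1)/2} b^{k(k-1)/2}`
(both exponents are nonnegative integers). -/
def ramanujanTheta (a b : ℤ⟦X⟧) : ℤ⟦X⟧ :=
  ∑' k : ℤ, a ^ (k * (k + 1) / 2).toNat * b ^ (k * (k - 1) / 2).toNat

/-- `φ(q) = f(q, q)`. -/
def thetaPhi (q : ℤ⟦X⟧) : ℤ⟦X⟧ := ramanujanTheta q q

/-- `ψ(q) = f(q, q³)`. -/
def thetaPsi (q : ℤ⟦X⟧) : ℤ⟦X⟧ := ramanujanTheta q (q ^ 3)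

/-- The term `(-1)^n q^{pn(n+1)/2 + jn + j} / (1 - q^{pn+j})`, as a Laurent series in `q`. For
`pn + j < 0` this is its expansion in `0 < |q| < 1`, since `1 - q^{pn+j}` is a unit. -/
def appellLerchTerm (j p : ℕ) (n : ℤ) : LaurentSeries ℤ :=
  HahnSeries.single (p * (n * (n + 1) / 2) + j * n + j) (n.negOnePow : ℤ) *
    Ring.inverse (1 - HahnSeries.single (p * n + j) (1 : ℤ))

/-- `∑_{n ∈ ℤ} (-1)^n q^{pn(n+1)/2 + jn + j} / (1 - q^{pn+j})`, summed coefficientwise. For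
`0 < j < p` only finitely many terms contribute to each coefficient and no negative power
of `q` occurs, see `appellLerchTerm_coeff_eq_zero`. -/
def appellLerchSum (j p : ℕ) : ℤ⟦X⟧ :=
  PowerSeries.mk fun k => ∑ᶠ n : ℤ, (appellLerchTerm j p n).coeff (k : ℤ)

/-- The generating function of `a_{j,p}`, for `0 < j < p`. -/
def appellLerchGen (j p : ℕ) : ℤ⟦X⟧ :=
  Ring.inverse (qPoch (X ^ j) (X ^ p) * qPoch (X ^ (p - j)) (X ^ p) * qPoch (X ^ p) (X ^ p)) *
    appellLerchSum j p

/-- The coefficients `a_{j,p}(n)` of Chan's Appell–Lerch sum. -/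
def appellLerchA (j p n : ℕ) : ℤ := PowerSeries.coeff n (appellLerchGen j p)

/-- For an exponent `m ≠ 0`, `1 - q^m` is invertible among Laurent series. -/
theorem isUnit_one_sub_single {m : ℤ} (hm : m ≠ 0) :
    IsUnit (1 - HahnSeries.single m (1 : ℤ) : LaurentSeries ℤ) ∧
      (1 - HahnSeries.single m (1 : ℤ) : LaurentSeries ℤ).order = min 0 m := by
  have pos : ∀ m : ℤ, 0 < m → IsUnit (1 - HahnSeries.single m (1 : ℤ) : LaurentSeries ℤ) ∧
      (1 - HahnSeries.single m (1 : ℤ) : LaurentSeries ℤ).order = 0 := by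
    intro m hm
    have h0 : (1 - HahnSeries.single m (1 : ℤ) : LaurentSeries ℤ).coeff 0 = 1 := by
      simp [HahnSeries.coeff_single_of_ne hm.ne]
    have hne : (1 - HahnSeries.single m (1 : ℤ) : LaurentSeries ℤ) ≠ 0 := by
      intro h; rw [h] at h0; simp at h0
    have ho : (1 - HahnSeries.single m (1 : ℤ) : LaurentSeries ℤ).order = 0 := by
      apply le_antisymm
      · exact HahnSeries.order_le_of_coeff_ne_zero (by rw [h0]; exact one_ne_zero)
      · by_contra hlt
        push Not at hlt
        apply mt HahnSeries.coeff_order_eq_zero.mp hne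
        rw [HahnSeries.coeff_sub, HahnSeries.coeff_one, if_neg hlt.ne,
          HahnSeries.coeff_single_of_ne (by lia), sub_zero]
    refine ⟨?_, ho⟩
    rw [HahnSeries.isUnit_iff, HahnSeries.leadingCoeff_eq, ho, h0]
    exact isUnit_one
  rcases lt_or_gt_of_ne hm with h | h
  · obtain ⟨hu, ho⟩ := pos (-m) (by lia)
    have key : (1 - HahnSeries.single m (1 : ℤ) : LaurentSeries ℤ) =
        HahnSeries.single m (-1 : ℤ) * (1 - HahnSeries.single (-m) (1 : ℤ)) := by
      rw [mul_sub, mul_one, HahnSeries.single_mul_single]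
      simp only [add_neg_cancel, mul_one, HahnSeries.single_neg]
      rw [show (HahnSeries.single (0 : ℤ) (1 : ℤ) : LaurentSeries ℤ) = 1 from rfl]
      ring
    have hs : IsUnit (HahnSeries.single m (-1 : ℤ) : LaurentSeries ℤ) := by
      rw [HahnSeries.isUnit_iff, HahnSeries.leadingCoeff_of_single]
      exact isUnit_one.neg
    refine ⟨key ▸ hs.mul hu, ?_⟩
    rw [key, HahnSeries.order_mul hs.ne_zero hu.ne_zero, ho,
      HahnSeries.order_single (by norm_num)]
    lia
  · obtain ⟨hu, ho⟩ := pos m h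
    exact ⟨hu, by rw [ho]; lia⟩

/-- For `0 < j < p` the `n`-th term only involves powers `q^k` with `k ≥ |n|`. -/
theorem appellLerchTerm_coeff_eq_zero {j p : ℕ} (hj : 0 < j) (hp : j < p) {n k : ℤ}
    (hk : k < |n|) : (appellLerchTerm j p n).coeff k = 0 := by
  have hm : (p * n + j : ℤ) ≠ 0 := by
    intro h
    rcases lt_or_ge n 0 with hn | hn
    · nlinarith
    · nlinarith
  obtain ⟨hu, ho⟩ := isUnit_one_sub_single hm
  have hi : IsUnit (Ring.inverse (1 - HahnSeries.single (p * n + j : ℤ) (1 : ℤ)) :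
      LaurentSeries ℤ) := hu.ringInverse
  have hio := HahnSeries.order_mul hu.ne_zero hi.ne_zero
  rw [Ring.mul_inverse_cancel _ hu, HahnSeries.order_one, ho] at hio
  have hc : ((n.negOnePow : ℤˣ) : ℤ) ≠ 0 := n.negOnePow.isUnit.ne_zero
  apply HahnSeries.coeff_eq_zero_of_lt_order
  rw [appellLerchTerm, HahnSeries.order_mul (HahnSeries.single_ne_zero hc) hi.ne_zero,
    HahnSeries.order_single hc]
  refine hk.trans_le ?_
  have he : 2 * (n * (n + 1) / 2) = n * (n + 1) :=
    Int.mul_ediv_cancel' (Int.even_mul_succ_self n).two_dvd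
  have hj' : (1 : ℤ) ≤ j := by exact_mod_cast hj
  have hp' : (j : ℤ) + 1 ≤ p := by exact_mod_cast hp
  rcases lt_or_ge n 0 with hn | hn
  · have : (p * n + j : ℤ) < 0 := by nlinarith
    rw [abs_of_neg hn]
    rw [min_eq_right this.le] at hio
    have h1 : 0 ≤ (p : ℤ) * (n * (n + 1) - 2 * n - 2 * (-n)) := by nlinarith
    nlinarith [mul_nonneg (show (0 : ℤ) ≤ p - j - 1 by lia) (show 0 ≤ -n by lia),
      mul_nonneg (show (0 : ℤ) ≤ p by lia) (show (0 : ℤ) ≤ n * (n + 1) by nlinarith)]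
  · have : (0 : ℤ) ≤ p * n + j := by positivity
    rw [abs_of_nonneg hn]
    rw [min_eq_left this] at hio
    nlinarith [mul_nonneg (show (0 : ℤ) ≤ p by lia) (show (0 : ℤ) ≤ n * (n + 1) by nlinarith)]

end

/-! Expanding geometric series turns Chan's sum into a double series over the quadrants `0 ≤ n, i`
and `n, i < 0`. A shear of its product with `f(-q^j, -q^{p-j})` leaves a family of sums that are
antisymmetric and vanish, except for one, which is `E_p³` by Jacobi's identity. For odd `j` and
`p = 2r`, the product of the sum with `f(q^j, q^{p-j})` agrees at odd powers of `q` with such a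
double series at `q²`, because the difference is antisymmetric under a reflection. Hence the series
of the odd-indexed coefficients of `a_{1,10}` is an infinite product. With
`a, b, c, d = (q^i, q^{10-i}; q^{10})_∞` for `i = 1, 2, 3, 4`, `e = (q⁵; q^{10})_∞` and
`J = E_{10}`, it is `b J / (a³ d e)`.

Splitting products of two theta functions along sublattices of `ℤ²` of index two, three and five
gives relations between these products, of which the generating function is a consequence.

Modulo five, `e` and `J` are series in `q⁵`, so they are constants for `D = q d/dq`. The relations
express the remaining factor through Ramanujan's parameter `k = q a b / (c d)`, which satisfies
`(1 + k - k²) D k = k (1 - k²)`. This exhibits the product as `D G - 2 G` for a power series `G`, so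
its coefficients at the exponents `5n + 2` vanish. -/

noncomputable section

/-! ### Sums of monomials over lattices -/

theorem t3Space_powerSeries (R : Type*) [TopologicalSpace R] [T3Space R] : T3Space R⟦X⟧ :=
  inferInstanceAs (T3Space ((Unit →₀ ℕ) → R))

section LatticeSum

variable {R : Type*} [CommRing R] {ι κ : Type*} {w w' : ι → ℤ} {c c' : ι → R}
  {v : κ → ℤ} {b : κ → R}

/-- The power series `∑ c(i) X^{w(i)}`. Negative exponents are truncated to `0`, so it is only
meaningful if `c` vanishes where `w` is negative, see `LatticeSummable`. -/
def latticeSum [TopologicalSpace R] (w : ι → ℤ) (c : ι → R) : R⟦X⟧ :=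
  ∑' i, C (c i) * X ^ (w i).toNat

/-- The formal sum `∑ c(i) X^{w(i)}` is a power series: no negative power of `X` occurs, and each
power occurs finitely often. -/
structure LatticeSummable (w : ι → ℤ) (c : ι → R) : Prop where
  nonneg : ∀ i, c i ≠ 0 → 0 ≤ w i
  finite : ∀ d : ℤ, {i | c i ≠ 0 ∧ w i ≤ d}.Finite

namespace LatticeSummable

theorem of_support (h : LatticeSummable w c) (hc : ∀ i, c' i ≠ 0 → c i ≠ 0) :
    LatticeSummable w c' where
  nonneg i hi := h.nonneg i (hc i hi)
  finite d := (h.finite d).subset fun i hi => ⟨hc i hi.1, hi.2⟩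

theorem congr (h : LatticeSummable w c) (hw : ∀ i, c i ≠ 0 → w i = w' i) :
    LatticeSummable w' c where
  nonneg i hi := hw i hi ▸ h.nonneg i hi
  finite d := (h.finite d).subset fun i hi => ⟨hi.1, hw i hi.1 ▸ hi.2⟩

theorem comp_injective (h : LatticeSummable w c) {g : κ → ι} (hg : Function.Injective g) :
    LatticeSummable (fun k => w (g k)) (fun k => c (g k)) where
  nonneg k := h.nonneg (g k)
  finite d := (h.finite d).preimage hg.injOn

theorem add_const (h : LatticeSummable w c) {k : ℤ} (hk : 0 ≤ k) :
    LatticeSummable (fun i => w i + k) c where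
  nonneg i hi := add_nonneg (h.nonneg i hi) hk
  finite d := (h.finite (d - k)).subset fun i hi => ⟨hi.1, by linarith [hi.2]⟩

theorem prod (h : LatticeSummable w c) (hv : LatticeSummable v b) :
    LatticeSummable (fun x : ι × κ => w x.1 + v x.2) (fun x => c x.1 * b x.2) where
  nonneg x hx := add_nonneg (h.nonneg _ (left_ne_zero_of_mul hx))
    (hv.nonneg _ (right_ne_zero_of_mul hx))
  finite d := by
    refine ((h.finite d).prod (hv.finite d)).subset ?_
    rintro ⟨i, k⟩ ⟨hik, hd : w i + v k ≤ d⟩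
    have hi := left_ne_zero_of_mul hik
    have hk := right_ne_zero_of_mul hik
    exact ⟨⟨hi, by linarith [hv.nonneg k hk]⟩, hk, by linarith [h.nonneg i hi]⟩

theorem of_abs_le {w : ℤ → ℤ} {c : ℤ → R} (K : ℤ) (h0 : ∀ i, c i ≠ 0 → 0 ≤ w i)
    (h : ∀ i, c i ≠ 0 → |i| ≤ w i + K) : LatticeSummable w c where
  nonneg := h0
  finite d := (Set.finite_Icc (-(d + K)) (d + K)).subset fun i hi =>
    abs_le.mp (by linarith [h i hi.1, hi.2])

theorem of_abs_le_prod {w : ℤ × ℤ → ℤ} {c : ℤ × ℤ → R} (K : ℤ) (h0 : ∀ x, c x ≠ 0 → 0 ≤ w x)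
    (h : ∀ i j, c (i, j) ≠ 0 → |i| ≤ w (i, j) + K ∧ |j| ≤ w (i, j) + K) :
    LatticeSummable w c where
  nonneg := h0
  finite d := by
    refine ((Set.finite_Icc (-(d + K)) (d + K)).prod
      (Set.finite_Icc (-(d + K)) (d + K))).subset ?_
    rintro ⟨i, j⟩ ⟨hij, hd⟩
    obtain ⟨hi, hj⟩ := h i j hij
    exact ⟨abs_le.mp (by linarith), abs_le.mp (by linarith)⟩

theorem summable_coeff [TopologicalSpace R] (h : LatticeSummable w c) (d : ℕ) :
    Summable fun i => if d = (w i).toNat then c i else 0 := by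
  refine summable_of_hasFiniteSupport ((h.finite d).subset fun i hi => ?_)
  obtain ⟨hd, hc⟩ := ite_ne_right_iff.mp hi
  exact ⟨hc, by lia⟩

theorem summable [TopologicalSpace R] (h : LatticeSummable w c) :
    Summable fun i => (C (c i) * X ^ (w i).toNat : R⟦X⟧) := by
  rw [PowerSeries.WithPiTopology.summable_iff_summable_coeff]
  simpa only [coeff_C_mul, coeff_X_pow, mul_ite, mul_one, mul_zero] using h.summable_coeff

end LatticeSummable

variable [TopologicalSpace R]

theorem latticeSum_congr (hc : ∀ i, c i = c' i) (hw : ∀ i, c i ≠ 0 → w i = w' i) :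
    latticeSum w c = latticeSum w' c' := by
  refine tsum_congr fun i => ?_
  by_cases h : c i = 0
  · rw [← hc i, h, map_zero, zero_mul, zero_mul]
  · rw [← hc i, hw i h]

theorem latticeSum_equiv (e : κ ≃ ι) (w : ι → ℤ) (c : ι → R) :
    latticeSum (fun k => w (e k)) (fun k => c (e k)) = latticeSum w c :=
  e.tsum_eq fun i => (C (c i) * X ^ (w i).toNat : R⟦X⟧)

variable [DiscreteTopology R]

theorem latticeSum_add (h : LatticeSummable w c) (h' : LatticeSummable w c') :
    latticeSum w (fun i => c i + c' i) = latticeSum w c + latticeSum w c' := by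
  rw [latticeSum, latticeSum, latticeSum, ← h.summable.tsum_add h'.summable]
  exact tsum_congr fun i => by rw [map_add, add_mul]

theorem latticeSum_neg (w : ι → ℤ) (c : ι → R) :
    latticeSum w (fun i => -c i) = -latticeSum w c := by
  rw [latticeSum, latticeSum, ← tsum_neg]
  exact tsum_congr fun i => by rw [map_neg, neg_mul]

theorem latticeSum_sub (h : LatticeSummable w c) (h' : LatticeSummable w c') :
    latticeSum w (fun i => c i - c' i) = latticeSum w c - latticeSum w c' := by
  rw [latticeSum, latticeSum, latticeSum, ← h.summable.tsum_sub h'.summable]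
  exact tsum_congr fun i => by rw [map_sub, sub_mul]

theorem C_mul_X_pow_mul_latticeSum (a : R) (k : ℕ) (h : LatticeSummable w c) :
    C a * X ^ k * latticeSum w c = latticeSum (fun i => w i + k) (fun i => a * c i) := by
  rw [latticeSum, latticeSum, ← h.summable.tsum_mul_left]
  refine tsum_congr fun i => ?_
  by_cases hi : c i = 0
  · rw [hi, mul_zero, map_zero, zero_mul, zero_mul, mul_zero]
  · rw [show (w i + k).toNat = k + (w i).toNat by have := h.nonneg i hi; lia, pow_add, map_mul]
    ring

theorem X_pow_mul_latticeSum (k : ℕ) (h : LatticeSummable w c) :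
    X ^ k * latticeSum w c = latticeSum (fun i => w i + k) c := by
  simpa only [map_one, one_mul] using C_mul_X_pow_mul_latticeSum 1 k h

theorem latticeSum_mul (h : LatticeSummable w c) (hv : LatticeSummable v b) :
    latticeSum w c * latticeSum v b =
      latticeSum (fun x : ι × κ => w x.1 + v x.2) (fun x => c x.1 * b x.2) := by
  have := t3Space_powerSeries R
  have mul_term : ∀ x : ι × κ,
      (C (c x.1) * X ^ (w x.1).toNat * (C (b x.2) * X ^ (v x.2).toNat) : R⟦X⟧) =
        C (c x.1 * b x.2) * X ^ (w x.1 + v x.2).toNat := by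
    rintro ⟨i, k⟩
    by_cases hi : c i = 0
    · simp [hi]
    by_cases hk : b k = 0
    · simp [hk]
    rw [Int.toNat_add (h.nonneg i hi) (hv.nonneg k hk), pow_add, map_mul]
    ring
  have hs := (h.prod hv).summable
  simp only [← mul_term] at hs
  rw [latticeSum, latticeSum, latticeSum, h.summable.tsum_mul_tsum hv.summable hs]
  exact tsum_congr mul_term

theorem latticeSum_eq_zero [IsAddTorsionFree R] (σ : ι ≃ ι) (hw : ∀ i, c i ≠ 0 → w (σ i) = w i)
    (hc : ∀ i, c (σ i) = -c i) : latticeSum w c = 0 := by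
  have hneg : latticeSum w c = -latticeSum w c := by
    conv_lhs => rw [← latticeSum_equiv σ w c]
    rw [← latticeSum_neg]
    exact latticeSum_congr hc fun i hi => hw i fun h0 => hi (by rw [hc, h0, neg_zero])
  ext d
  exact self_eq_neg.mp (congrArg (coeff d) hneg)

theorem coeff_latticeSum (h : LatticeSummable w c) (d : ℕ) :
    coeff d (latticeSum w c) = ∑' i, if d = (w i).toNat then c i else 0 := by
  rw [latticeSum,
    ← ((PowerSeries.WithPiTopology.hasSum_iff_hasSum_coeff R).mp h.summable.hasSum d).tsum_eq]
  exact tsum_congr fun i => by rw [coeff_C_mul, coeff_X_pow, mul_ite, mul_one, mul_zero]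

theorem latticeSum_prod {w : ι × κ → ℤ} {c : ι × κ → R} (h : LatticeSummable w c) :
    latticeSum w c = ∑' i, latticeSum (fun k => w (i, k)) (fun k => c (i, k)) := by
  have := t3Space_powerSeries R
  exact h.summable.tsum_prod' fun i => (h.comp_injective (Prod.mk_right_injective i)).summable

theorem latticeSum_eq_sum {m : ℕ} (h : LatticeSummable w c) (g : Fin m → κ → ι)
    (hg : Function.Bijective fun x : Fin m × κ => g x.1 x.2) :
    latticeSum w c = ∑ a, latticeSum (fun k => w (g a k)) (fun k => c (g a k)) := by
  refine (latticeSum_equiv (Equiv.ofBijective _ hg) w c).symm.trans ?_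
  exact (latticeSum_prod (h.comp_injective hg.injective)).trans (tsum_fintype _)

end LatticeSum

/-! ### The Jacobi triple product -/

theorem two_mul_half_mul_succ (k : ℤ) : 2 * (k * (k + 1) / 2) = k * (k + 1) :=
  Int.mul_ediv_cancel' (Int.even_mul_succ_self k).two_dvd

theorem two_mul_half_mul_pred (k : ℤ) : 2 * (k * (k - 1) / 2) = k * (k - 1) :=
  Int.mul_ediv_cancel' (Int.even_mul_pred_self k).two_dvd

theorem half_mul_succ_nonneg (k : ℤ) : 0 ≤ k * (k + 1) / 2 := by
  have := two_mul_half_mul_succ k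
  rcases le_or_gt 0 k with h | h <;> nlinarith

theorem half_mul_pred_nonneg (k : ℤ) : 0 ≤ k * (k - 1) / 2 := by
  have := two_mul_half_mul_pred k
  rcases le_or_gt 1 k with h | h <;> nlinarith

section ThetaMonomial

variable {A : Type*} [CommRing A]

/-- The summand `a^{k(k+1)/2} b^{k(k-1)/2}` of Ramanujan's theta function. -/
def thetaMonomial (a b : A) (k : ℤ) : A :=
  a ^ (k * (k + 1) / 2).toNat * b ^ (k * (k - 1) / 2).toNat

theorem thetaMonomial_neg (a b : A) (k : ℤ) : thetaMonomial a b (-k) = thetaMonomial b a k := by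
  rw [thetaMonomial, thetaMonomial, mul_comm, show -k * (-k - 1) = k * (k + 1) by ring,
    show -k * (-k + 1) = k * (k - 1) by ring]

theorem thetaMonomial_add_one (a b : A) {k : ℤ} (hk : 0 ≤ k) :
    thetaMonomial a b (k + 1) = a * (a * b) ^ k.toNat * thetaMonomial a b k := by
  have succ := two_mul_half_mul_succ k
  have pred := two_mul_half_mul_pred k
  have succ' := two_mul_half_mul_succ (k + 1)
  have pred' := two_mul_half_mul_pred (k + 1)
  have := half_mul_succ_nonneg k
  have := half_mul_pred_nonneg k
  have ha : ((k + 1) * (k + 1 + 1) / 2).toNat = 1 + k.toNat + (k * (k + 1) / 2).toNat := by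
    have : (k + 1) * (k + 1 + 1) / 2 = 1 + k + k * (k + 1) / 2 := by linarith
    lia
  have hb : ((k + 1) * (k + 1 - 1) / 2).toNat = k.toNat + (k * (k - 1) / 2).toNat := by
    have : (k + 1) * (k + 1 - 1) / 2 = k + k * (k - 1) / 2 := by linarith
    lia
  rw [thetaMonomial, thetaMonomial, ha, hb]
  ring

theorem mul_pow_mul_thetaMonomial (a b : A) {n k : ℤ} (hsub : 0 ≤ n - k) (hadd : 0 ≤ n + k) :
    a * (a * b) ^ n.toNat * thetaMonomial a b k =
      (a * b) ^ (n - k).toNat * thetaMonomial a b (k + 1) := by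
  rcases le_or_gt 0 k with hk | hk
  · rw [thetaMonomial_add_one a b hk, show n.toNat = (n - k).toNat + k.toNat by lia]
    ring
  · obtain ⟨j, rfl⟩ : ∃ j : ℤ, k = -(j + 1) := ⟨-k - 1, by ring⟩
    rw [show -(j + 1) + 1 = -j by ring, thetaMonomial_neg, thetaMonomial_neg,
      thetaMonomial_add_one b a (by lia : 0 ≤ j),
      show (n - -(j + 1)).toNat = n.toNat + j.toNat + 1 by lia]
    ring

theorem mul_pow_mul_thetaMonomial' (a b : A) {n k : ℤ} (hsub : 0 ≤ n - k) (hadd : 0 ≤ n + k) :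
    b * (a * b) ^ n.toNat * thetaMonomial a b k =
      (a * b) ^ (n + k).toNat * thetaMonomial a b (k - 1) := by
  have h := mul_pow_mul_thetaMonomial b a (n := n) (k := -k) (by lia) (by lia)
  rwa [thetaMonomial_neg, show -k + 1 = -(k - 1) by ring, thetaMonomial_neg, mul_comm b a,
    sub_neg_eq_add] at h

end ThetaMonomial

section JacobiTriple

open Filter Topology

variable {R : Type*} [CommRing R] {q : R⟦X⟧}

/-- The inverse of `(q; q)_n`, extended by zero to negative `n`. -/
def invQFactorial (q : R⟦X⟧) (n : ℤ) : R⟦X⟧ :=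
  if 0 ≤ n then ∏ k ∈ Finset.range n.toNat, invOfUnit (1 - q ^ (k + 1)) 1 else 0

theorem invQFactorial_of_neg (q : R⟦X⟧) {n : ℤ} (hn : n < 0) : invQFactorial q n = 0 :=
  if_neg (by lia)

theorem one_sub_pow_mul_invOfUnit (hq : X ∣ q) (k : ℕ) :
    (1 - q ^ (k + 1)) * invOfUnit (1 - q ^ (k + 1)) 1 = 1 := by
  apply mul_invOfUnit
  rw [map_sub, map_pow, X_dvd_iff.mp hq, zero_pow k.succ_ne_zero, map_one, sub_zero, Units.val_one]

theorem invQFactorial_eq_mul_one_sub (hq : X ∣ q) (m : ℤ) :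
    invQFactorial q m = invQFactorial q (m + 1) * (1 - q ^ (m + 1).toNat) := by
  rcases lt_trichotomy (m + 1) 0 with h | h | h
  · rw [invQFactorial_of_neg q h, invQFactorial_of_neg q (by lia), zero_mul]
  · rw [h, invQFactorial_of_neg q (by lia), Int.toNat_zero, pow_zero, sub_self, mul_zero]
  · rw [invQFactorial, invQFactorial, if_pos (by lia), if_pos (by lia),
      show (m + 1).toNat = m.toNat + 1 by lia, Finset.prod_range_succ, mul_assoc,
      mul_comm (invOfUnit _ _), one_sub_pow_mul_invOfUnit hq, mul_one]

/-- The Gaussian binomial coefficient `[2n, n+k]_q`, which is the `k`-th coefficient of the finite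
form of the triple product; it is zero for `|k| > n`. -/
def finiteTripleCoeff (q : R⟦X⟧) (n : ℕ) (k : ℤ) : R⟦X⟧ :=
  (∏ i ∈ Finset.range (2 * n), (1 - q ^ (i + 1))) *
    (invQFactorial q (n - k) * invQFactorial q (n + k))

theorem finiteTripleCoeff_eq_zero (q : R⟦X⟧) {n : ℕ} {k : ℤ}
    (h : (n : ℤ) - k < 0 ∨ (n : ℤ) + k < 0) : finiteTripleCoeff q n k = 0 := by
  rcases h with h | h <;> rw [finiteTripleCoeff, invQFactorial_of_neg q h] <;> ring

theorem one_sub_pow_toNat_mul_pow (q : R⟦X⟧) {m l : ℤ} (hm : 0 ≤ m) (hl : 0 ≤ l) :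
    (1 - q ^ m.toNat) * (q ^ l.toNat * q ^ (m - 1).toNat) =
      (1 - q ^ m.toNat) * q ^ (m + l - 1).toNat := by
  rcases hm.eq_or_lt with rfl | hm
  · rw [Int.toNat_zero, pow_zero, sub_self, zero_mul, zero_mul]
  · rw [← pow_add, show l.toNat + (m - 1).toNat = (m + l - 1).toNat by lia]

/-- The sum of two `q`-Pascal steps, cleared of the product `(q; q)_{2n}`. -/
theorem invQFactorial_mul_invQFactorial_step (hq : X ∣ q) {m l : ℤ} (hm : 0 ≤ m) (hl : 0 ≤ l) :
    (1 - q ^ (m + l - 1).toNat) * (1 - q ^ (m + l).toNat) *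
        (invQFactorial q m * invQFactorial q l) =
      invQFactorial q (m - 1) * invQFactorial q (l - 1) * (1 + q ^ (m + l - 1).toNat) +
        invQFactorial q m * invQFactorial q (l - 2) * q ^ m.toNat +
        invQFactorial q (m - 2) * invQFactorial q l * q ^ l.toNat := by
  have pred (i : ℤ) : invQFactorial q (i - 1) = invQFactorial q i * (1 - q ^ i.toNat) := by
    rw [invQFactorial_eq_mul_one_sub hq, sub_add_cancel]
  have pred_pred (i : ℤ) : invQFactorial q (i - 2) =
      invQFactorial q i * (1 - q ^ i.toNat) * (1 - q ^ (i - 1).toNat) := by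
    rw [← pred, ← pred, sub_sub, one_add_one_eq_two]
  have shift_m := one_sub_pow_toNat_mul_pow q hm hl
  have shift_l := one_sub_pow_toNat_mul_pow q hl hm
  rw [add_comm l m] at shift_l
  rw [pred, pred, pred_pred, pred_pred, Int.toNat_add hm hl, pow_add]
  linear_combination invQFactorial q m * invQFactorial q l * (shift_m + shift_l)

theorem finiteTripleCoeff_succ (hq : X ∣ q) (n : ℕ) (k : ℤ) :
    finiteTripleCoeff q (n + 1) k =
      finiteTripleCoeff q n k * (1 + q ^ (2 * n + 1)) +
      finiteTripleCoeff q n (k - 1) * q ^ ((n : ℤ) - (k - 1)).toNat +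
      finiteTripleCoeff q n (k + 1) * q ^ ((n : ℤ) + (k + 1)).toNat := by
  by_cases hneg : (n : ℤ) - (k - 1) < 0 ∨ (n : ℤ) + (k + 1) < 0
  · rw [finiteTripleCoeff_eq_zero q (n := n + 1) (by push_cast; lia),
      finiteTripleCoeff_eq_zero q (by lia), finiteTripleCoeff_eq_zero q (by lia),
      finiteTripleCoeff_eq_zero q (by lia)]
    ring
  have step := invQFactorial_mul_invQFactorial_step hq (m := n - (k - 1)) (l := n + (k + 1))
    (by lia) (by lia)
  simp only [finiteTripleCoeff]
  rw [show 2 * (n + 1) = 2 * n + 1 + 1 by ring, Finset.prod_range_succ, Finset.prod_range_succ,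
    show ((n + 1 : ℕ) : ℤ) - k = n - (k - 1) by push_cast; ring,
    show ((n + 1 : ℕ) : ℤ) + k = n + (k + 1) by push_cast; ring]
  rw [show ((n - (k - 1) + (n + (k + 1)) - 1 : ℤ)).toNat = 2 * n + 1 by lia,
    show ((n - (k - 1) + (n + (k + 1)) : ℤ)).toNat = 2 * n + 1 + 1 by lia,
    show (n - (k - 1) - 1 : ℤ) = n - k by ring, show (n + (k + 1) - 1 : ℤ) = n + k by ring,
    show (n - (k - 1) - 2 : ℤ) = n - (k + 1) by ring,
    show (n + (k + 1) - 2 : ℤ) = n + (k - 1) by ring] at step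
  linear_combination (∏ i ∈ Finset.range (2 * n), (1 - q ^ (i + 1))) * step

theorem finiteTripleCoeff_succ_mul_thetaMonomial {a b : R⟦X⟧} (hab : X ∣ a * b) (n : ℕ) (k : ℤ) :
    finiteTripleCoeff (a * b) (n + 1) k * thetaMonomial a b k =
      finiteTripleCoeff (a * b) n k * thetaMonomial a b k * (1 + (a * b) ^ (2 * n + 1)) +
      finiteTripleCoeff (a * b) n (k - 1) * thetaMonomial a b (k - 1) * (a * (a * b) ^ n) +
      finiteTripleCoeff (a * b) n (k + 1) * thetaMonomial a b (k + 1) * (b * (a * b) ^ n) := by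
  have right_term : finiteTripleCoeff (a * b) n (k - 1) *
      ((a * b) ^ ((n : ℤ) - (k - 1)).toNat * thetaMonomial a b k -
        a * (a * b) ^ n * thetaMonomial a b (k - 1)) = 0 := by
    by_cases hn : (n : ℤ) - (k - 1) < 0 ∨ (n : ℤ) + (k - 1) < 0
    · rw [finiteTripleCoeff_eq_zero _ hn, zero_mul]
    · have h := mul_pow_mul_thetaMonomial a b (n := n) (k := k - 1) (by lia) (by lia)
      rw [sub_add_cancel, Int.toNat_natCast] at h
      rw [h, sub_self, mul_zero]
  have left_term : finiteTripleCoeff (a * b) n (k + 1) *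
      ((a * b) ^ ((n : ℤ) + (k + 1)).toNat * thetaMonomial a b k -
        b * (a * b) ^ n * thetaMonomial a b (k + 1)) = 0 := by
    by_cases hn : (n : ℤ) - (k + 1) < 0 ∨ (n : ℤ) + (k + 1) < 0
    · rw [finiteTripleCoeff_eq_zero _ hn, zero_mul]
    · have h := mul_pow_mul_thetaMonomial' a b (n := n) (k := k + 1) (by lia) (by lia)
      rw [add_sub_cancel_right, Int.toNat_natCast] at h
      rw [h, sub_self, mul_zero]
  rw [finiteTripleCoeff_succ hab]
  linear_combination right_term + left_term

theorem X_pow_dvd_thetaMonomial {a b : R⟦X⟧} (hab : X ∣ a * b) {d : ℕ} {k : ℤ}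
    (hk : (d : ℤ) < |k|) : X ^ d ∣ thetaMonomial a b k := by
  have pos : ∀ {a b : R⟦X⟧}, X ∣ a * b → ∀ k : ℤ, d < k → X ^ d ∣ thetaMonomial a b k := by
    intro a b hab k hk
    obtain ⟨m, rfl⟩ : ∃ m, k = m + 1 := ⟨k - 1, by ring⟩
    rw [thetaMonomial_add_one a b (by lia)]
    exact (((pow_dvd_pow _ (by lia)).trans (pow_dvd_pow_of_dvd hab _)).mul_left _).mul_right _
  rcases lt_abs.mp hk with h | h
  · exact pos hab k h
  · rw [← neg_neg k, thetaMonomial_neg]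
    exact pos (mul_comm a b ▸ hab) (-k) h

variable [TopologicalSpace R]

theorem multipliable_one_add_of_X_pow_dvd {f : ℕ → R⟦X⟧} (h : ∀ k, X ^ k ∣ f k) :
    Multipliable fun k => 1 + f k := by
  apply PowerSeries.WithPiTopology.multipliable_one_add_of_tendsto_order_atTop_nhds_top
  refine ENat.tendsto_nhds_top_iff_natCast_lt.mpr fun n => eventually_atTop.mpr ⟨n + 1, ?_⟩
  intro m hm
  exact lt_of_lt_of_le (by exact_mod_cast hm)
    (nat_le_order (f m) m fun i hi => X_pow_dvd_iff.mp (h m) i hi)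

theorem multipliable_one_add_mul_pow (hq : X ∣ q) (a : R⟦X⟧) :
    Multipliable fun k : ℕ => 1 + a * q ^ k :=
  multipliable_one_add_of_X_pow_dvd fun k => (pow_dvd_pow_of_dvd hq k).mul_left a

theorem multipliable_one_sub_mul_pow (hq : X ∣ q) (a : R⟦X⟧) :
    Multipliable fun k : ℕ => 1 - a * q ^ k :=
  (multipliable_one_add_mul_pow hq (-a)).congr fun k => by rw [neg_mul, sub_eq_add_neg]

theorem multipliable_one_sub_pow_succ (hq : X ∣ q) :
    Multipliable fun k : ℕ => 1 - q ^ (k + 1) :=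
  (multipliable_one_sub_mul_pow hq q).congr fun k => by rw [pow_succ']

variable [DiscreteTopology R]

theorem hasSum_finiteTripleCoeff {a b : R⟦X⟧} (hab : X ∣ a * b) (n : ℕ) :
    HasSum (fun k : ℤ => finiteTripleCoeff (a * b) n k * thetaMonomial a b k)
      (∏ k ∈ Finset.range n, ((1 + a * (a * b) ^ k) * (1 + b * (a * b) ^ k))) := by
  induction n with
  | zero =>
    have h := hasSum_single (f := fun k => finiteTripleCoeff (a * b) 0 k * thetaMonomial a b k) 0
      fun k hk => by rw [finiteTripleCoeff_eq_zero _ (by lia), zero_mul]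
    simpa [finiteTripleCoeff, thetaMonomial, invQFactorial] using h
  | succ n ih =>
    have shift_right := (Equiv.subRight (1 : ℤ)).hasSum_iff.mpr (ih.mul_right (a * (a * b) ^ n))
    have shift_left := (Equiv.addRight (1 : ℤ)).hasSum_iff.mpr (ih.mul_right (b * (a * b) ^ n))
    have h := ((ih.mul_right (1 + (a * b) ^ (2 * n + 1))).add shift_right).add shift_left
    rw [Finset.prod_range_succ, show (1 + a * (a * b) ^ n) * (1 + b * (a * b) ^ n) =
      1 + (a * b) ^ (2 * n + 1) + a * (a * b) ^ n + b * (a * b) ^ n by ring, mul_add, mul_add]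
    exact h.congr_fun (finiteTripleCoeff_succ_mul_thetaMonomial hab n)

theorem tendsto_invQFactorial (hq : X ∣ q) :
    ∃ u : R⟦X⟧, Tendsto (fun n : ℕ => invQFactorial q n) atTop (𝓝 u) ∧
      u * ∏' k : ℕ, (1 - q ^ (k + 1)) = 1 := by
  have hm : Multipliable fun k : ℕ => invOfUnit (1 - q ^ (k + 1)) 1 := by
    refine (multipliable_one_add_of_X_pow_dvd
      (f := fun k => q ^ (k + 1) * invOfUnit (1 - q ^ (k + 1)) 1) fun k => ?_).congr fun k => ?_
    · exact ((pow_dvd_pow _ k.le_succ).trans (pow_dvd_pow_of_dvd hq _)).mul_right _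
    · linear_combination -one_sub_pow_mul_invOfUnit hq k
  refine ⟨∏' k : ℕ, invOfUnit (1 - q ^ (k + 1)) 1, ?_, ?_⟩
  · refine hm.hasProd.tendsto_prod_nat.congr fun n => ?_
    rw [invQFactorial, if_pos n.cast_nonneg, Int.toNat_natCast]
  · rw [← hm.tprod_mul (multipliable_one_sub_pow_succ hq)]
    simp_rw [mul_comm (invOfUnit _ _), one_sub_pow_mul_invOfUnit hq]
    exact tprod_one

theorem tendsto_finiteTripleCoeff (hq : X ∣ q) :
    ∃ u : R⟦X⟧, (∀ k, Tendsto (fun n => finiteTripleCoeff q n k) atTop (𝓝 u)) ∧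
      u * ∏' k : ℕ, (1 - q ^ (k + 1)) = 1 := by
  obtain ⟨u, hu, hu_inv⟩ := tendsto_invQFactorial hq
  refine ⟨u, fun k => ?_, hu_inv⟩
  have tendsto_shift (l : ℤ) : Tendsto (fun n : ℕ => invQFactorial q (n + l)) atTop (𝓝 u) := by
    have ht : Tendsto (fun n : ℕ => (n + l : ℤ).toNat) atTop atTop :=
      tendsto_atTop_mono (f := fun n : ℕ => n - l.natAbs) (fun n => by lia)
        (tendsto_sub_atTop_nat _)
    refine (hu.comp ht).congr' ?_
    filter_upwards [eventually_ge_atTop l.natAbs] with n hn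
    rw [Function.comp_apply, Int.toNat_of_nonneg (by lia)]
  have tendsto_prod := (multipliable_one_sub_pow_succ hq).hasProd.tendsto_prod_nat.comp
    (tendsto_id.const_mul_atTop' two_pos)
  have h := tendsto_prod.mul ((tendsto_shift (-k)).mul (tendsto_shift k))
  rwa [← mul_assoc, mul_comm (∏' _, _) u, hu_inv, one_mul] at h

/-- Tannery's theorem; the uniform bound on the tails is that only finitely many `m k` are not
divisible by `X ^ d`. -/
theorem hasSum_mul_of_tendsto {ι : Type*} {F : ℕ → ι → R⟦X⟧} {u : ι → R⟦X⟧} {m : ι → R⟦X⟧}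
    {S : ℕ → R⟦X⟧} {s : R⟦X⟧} (hm : ∀ d : ℕ, {k | ¬X ^ d ∣ m k}.Finite)
    (hF : ∀ n, HasSum (fun k => F n k * m k) (S n))
    (hu : ∀ k, Tendsto (fun n => F n k) atTop (𝓝 (u k))) (hS : Tendsto S atTop (𝓝 s)) :
    HasSum (fun k => u k * m k) s := by
  rw [PowerSeries.WithPiTopology.hasSum_iff_hasSum_coeff]
  intro d
  have tendsto_coeff {f : ℕ → R⟦X⟧} {g : R⟦X⟧} (h : Tendsto f atTop (𝓝 g)) :=
    ((PowerSeries.WithPiTopology.continuous_coeff R d).tendsto g).comp h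
  have coeff_eq_zero (f : ι → R⟦X⟧) : ∀ k ∉ (hm (d + 1)).toFinset, coeff d (f k * m k) = 0 := by
    intro k hk
    rw [Set.Finite.mem_toFinset, Set.mem_ofPred_eq, not_not] at hk
    exact X_pow_dvd_iff.mp (hk.mul_left (f k)) d d.lt_succ_self
  have coeff_S (n : ℕ) : ∑ k ∈ (hm (d + 1)).toFinset, coeff d (F n k * m k) = coeff d (S n) :=
    (hasSum_sum_of_ne_finset_zero (coeff_eq_zero (F n))).unique
      ((PowerSeries.WithPiTopology.hasSum_iff_hasSum_coeff R).mp (hF n) d)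
  have tendsto_sum := tendsto_finsetSum (hm (d + 1)).toFinset fun k _ =>
    tendsto_coeff ((hu k).mul (tendsto_const_nhds (x := m k)))
  rw [tendsto_nhds_unique (tendsto_coeff hS) (tendsto_sum.congr coeff_S)]
  exact hasSum_sum_of_ne_finset_zero (coeff_eq_zero u)

theorem hasSum_thetaMonomial {a b : R⟦X⟧} (hab : X ∣ a * b) :
    HasSum (thetaMonomial a b)
      ((∏' k : ℕ, (1 + a * (a * b) ^ k)) * (∏' k : ℕ, (1 + b * (a * b) ^ k)) *
        ∏' k : ℕ, (1 - (a * b) ^ (k + 1))) := by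
  obtain ⟨u, hu, hu_inv⟩ := tendsto_finiteTripleCoeff hab
  have tendsto_prod := (multipliable_one_add_mul_pow hab a).hasProd.tendsto_prod_nat.mul
    (multipliable_one_add_mul_pow hab b).hasProd.tendsto_prod_nat
  have tail (d : ℕ) : {k : ℤ | ¬X ^ d ∣ thetaMonomial a b k}.Finite :=
    (Set.finite_Icc (-d : ℤ) d).subset fun k hk => abs_le.mp
      (not_lt.mp fun h => hk (X_pow_dvd_thetaMonomial hab h))
  have h := (hasSum_mul_of_tendsto tail (hasSum_finiteTripleCoeff hab) hu
    (tendsto_prod.congr fun n => Finset.prod_mul_distrib.symm)).mul_right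
    (∏' k : ℕ, (1 - (a * b) ^ (k + 1)))
  exact h.congr_fun fun k => by linear_combination -thetaMonomial a b k * hu_inv

end JacobiTriple

/-! ### Theta functions as lattice sums and as products -/

theorem X_dvd_X_pow {R : Type*} [CommSemiring R] {s : ℕ} (hs : 0 < s) : (X : R⟦X⟧) ∣ X ^ s :=
  dvd_pow_self X hs.ne'

section QPoch

variable {q : ℤ⟦X⟧}

theorem qPoch_eq_prod_qPoch (hq : X ∣ q) (a : ℤ⟦X⟧) {m : ℕ} (hm : 0 < m) :
    qPoch a q = ∏ r ∈ Finset.range m, qPoch (a * q ^ r) (q ^ m) := by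
  have : NeZero m := ⟨hm.ne'⟩
  let e : Fin m × ℕ ≃ ℕ := (Equiv.prodComm _ _).trans (Nat.divModEquiv m).symm
  have factor (r : Fin m) (k : ℕ) :
      1 - a * q ^ e (r, k) = 1 - a * q ^ (r : ℕ) * (q ^ m) ^ k := by
    rw [show e (r, k) = m * k + r by simp [e, Nat.divModEquiv]; ring]
    ring
  have multipliable : Multipliable fun x : Fin m × ℕ => 1 - a * q ^ e x :=
    e.multipliable_iff.mpr (multipliable_one_sub_mul_pow hq a)
  have fiber (r : Fin m) : Multipliable fun k : ℕ => 1 - a * q ^ e (r, k) :=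
    (multipliable_one_sub_mul_pow (dvd_pow hq hm.ne') (a * q ^ (r : ℕ))).congr
      fun k => (factor r k).symm
  rw [qPoch, ← e.tprod_eq fun k => 1 - a * q ^ k, multipliable.tprod_prod' fiber, tprod_fintype,
    ← Fin.prod_univ_eq_prod_range (fun r => qPoch (a * q ^ r) (q ^ m))]
  exact Finset.prod_congr rfl fun r _ => tprod_congr fun k => factor r k

theorem qPoch_neg_mul_qPoch (hq : X ∣ q) (a : ℤ⟦X⟧) :
    qPoch (-a) q * qPoch a q = qPoch (a ^ 2) (q ^ 2) := by
  rw [qPoch, qPoch, qPoch,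
    ← (multipliable_one_sub_mul_pow hq _).tprod_mul (multipliable_one_sub_mul_pow hq _)]
  exact tprod_congr fun k => by ring

theorem qPoch_eq_one_sub_mul (hq : X ∣ q) (a : ℤ⟦X⟧) :
    qPoch a q = (1 - a) * qPoch (a * q) q := by
  rw [qPoch, qPoch, tprod_eq_zero_mul' ((multipliable_one_sub_mul_pow hq (a * q)).congr
    fun k => by ring), pow_zero, mul_one]
  congr 1
  exact tprod_congr fun k => by ring

theorem qPoch_mul_eulerE {r : ℕ} (hr : 0 < r) :
    qPoch (X ^ r) (X ^ (2 * r)) * eulerE (2 * r) = eulerE r := by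
  rw [eulerE, eulerE, qPoch_eq_prod_qPoch (X_dvd_X_pow hr) _ (m := 2) (by lia),
    Finset.prod_range_succ, Finset.prod_range_one, pow_zero, mul_one, pow_one, ← pow_mul, ← pow_add,
    ← two_mul, mul_comm 2 r]

end QPoch

/-- The exponent of `X` in `(X^i)^{k(k+1)/2} (X^j)^{k(k-1)/2}`. -/
def thetaExp (i j k : ℤ) : ℤ := i * (k * (k + 1) / 2) + j * (k * (k - 1) / 2)

/-- The theta function `f(s X^i, s X^j)` for a sign `s`. -/
def theta (s : ℤˣ) (i j : ℕ) : ℤ⟦X⟧ :=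
  latticeSum (thetaExp i j) fun k => ((s ^ k : ℤˣ) : ℤ)

theorem two_mul_thetaExp (i j k : ℤ) : 2 * thetaExp i j k = (i + j) * k ^ 2 + (i - j) * k := by
  rw [thetaExp]
  linear_combination i * two_mul_half_mul_succ k + j * two_mul_half_mul_pred k

theorem thetaExp_nonneg (i j : ℕ) (k : ℤ) : 0 ≤ thetaExp i j k := by
  have := half_mul_succ_nonneg k
  have := half_mul_pred_nonneg k
  rw [thetaExp]
  positivity

theorem abs_le_thetaExp_add_one {i j : ℕ} (h : 0 < i + j) (k : ℤ) :
    |k| ≤ thetaExp i j k + 1 := by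
  rcases eq_or_ne k 0 with rfl | hk
  · simp [thetaExp]
  have abs_pos : 0 ≤ |k| - 1 := by linarith [Int.one_le_abs hk]
  have le_succ : |k| - 1 ≤ k * (k + 1) / 2 := by
    have := two_mul_half_mul_succ (k + 1)
    have := half_mul_succ_nonneg (k + 1)
    have := two_mul_half_mul_succ k
    rcases abs_cases k with ⟨hk', _⟩ | ⟨hk', _⟩ <;> rw [hk'] <;> nlinarith
  have le_pred : |k| - 1 ≤ k * (k - 1) / 2 := by
    have := two_mul_half_mul_pred (k - 1)
    have := half_mul_pred_nonneg (k - 1)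
    have := two_mul_half_mul_pred k
    rcases abs_cases k with ⟨hk', _⟩ | ⟨hk', _⟩ <;> rw [hk'] <;> nlinarith
  have hij : (1 : ℤ) ≤ i + j := by exact_mod_cast h
  rw [thetaExp]
  linarith [mul_le_mul_of_nonneg_left le_succ i.cast_nonneg,
    mul_le_mul_of_nonneg_left le_pred j.cast_nonneg, mul_le_mul_of_nonneg_right hij abs_pos]

theorem latticeSummable_thetaExp {R : Type*} [CommRing R] {i j : ℕ} (h : 0 < i + j) (c : ℤ → R) :
    LatticeSummable (thetaExp i j) c :=
  .of_abs_le 1 (fun k _ => thetaExp_nonneg i j k) fun k _ => abs_le_thetaExp_add_one h k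

theorem uzpow_eq_uzpow (s : ℤˣ) {k l : ℤ} (h : 2 ∣ k - l) : s ^ k = s ^ l := by
  obtain ⟨m, hm⟩ := h
  rw [show k = l + 2 * m by linarith, zpow_add, zpow_mul, show s ^ (2 : ℤ) = 1 from
    Int.units_sq s, one_zpow, mul_one]

theorem thetaMonomial_X_pow (s : ℤˣ) (i j : ℕ) (k : ℤ) :
    thetaMonomial (C (s : ℤ) * X ^ i) (C (s : ℤ) * X ^ j : ℤ⟦X⟧) k =
      C ((s ^ k : ℤˣ) : ℤ) * X ^ (thetaExp i j k).toNat := by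
  obtain ⟨x, hx⟩ := Int.eq_ofNat_of_zero_le (half_mul_succ_nonneg k)
  obtain ⟨y, hy⟩ := Int.eq_ofNat_of_zero_le (half_mul_pred_nonneg k)
  have hs : s ^ k = s ^ (x + y) := by
    rw [← zpow_natCast]
    refine uzpow_eq_uzpow s ⟨-y, ?_⟩
    have := two_mul_half_mul_succ k
    have := two_mul_half_mul_pred k
    push_cast
    linarith
  rw [thetaMonomial, thetaExp, hx, hy, hs, Int.toNat_natCast, Int.toNat_natCast,
    show ((i : ℤ) * x + j * y).toNat = i * x + j * y by
      rw [← Nat.cast_mul, ← Nat.cast_mul, ← Nat.cast_add, Int.toNat_natCast],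
    Units.val_pow_eq_pow_val, map_pow]
  ring

theorem theta_eq_prod (s : ℤˣ) {i j : ℕ} (h : 0 < i + j) :
    theta s i j = qPoch (-(C (s : ℤ) * X ^ i)) (X ^ (i + j)) *
      qPoch (-(C (s : ℤ) * X ^ j)) (X ^ (i + j)) * eulerE (i + j) := by
  have hab : (C (s : ℤ) * X ^ i) * (C (s : ℤ) * X ^ j : ℤ⟦X⟧) = X ^ (i + j) := by
    have sq : (C (s : ℤ) * C (s : ℤ) : ℤ⟦X⟧) = 1 := by
      rw [← map_mul, ← Units.val_mul, Int.units_mul_self, Units.val_one, map_one]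
    linear_combination X ^ i * X ^ j * sq
  have triple := (hasSum_thetaMonomial (hab ▸ X_dvd_X_pow h)).tsum_eq
  simp only [thetaMonomial_X_pow, hab] at triple
  simp only [theta, latticeSum, triple, qPoch, eulerE, neg_mul, sub_neg_eq_add, pow_succ']

theorem theta_neg_one_eq_prod {i j : ℕ} (h : 0 < i + j) :
    theta (-1) i j = qPoch (X ^ i) (X ^ (i + j)) * qPoch (X ^ j) (X ^ (i + j)) *
      eulerE (i + j) := by
  simp only [theta_eq_prod _ h, Units.val_neg, Units.val_one, map_neg, map_one, neg_mul, one_mul,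
    neg_neg]

theorem theta_one_eq_prod {i j : ℕ} (h : 0 < i + j) :
    theta 1 i j = qPoch (-X ^ i) (X ^ (i + j)) * qPoch (-X ^ j) (X ^ (i + j)) *
      eulerE (i + j) := by
  simp only [theta_eq_prod _ h, Units.val_one, map_one, one_mul]

theorem ramanujanTheta_X_pow (i j : ℕ) : ramanujanTheta (X ^ i) (X ^ j) = theta 1 i j := by
  refine tsum_congr fun k => ?_
  simpa only [Units.val_one, map_one, one_mul, thetaMonomial] using thetaMonomial_X_pow 1 i j k

theorem thetaPhi_X_pow (r : ℕ) : thetaPhi (X ^ r) = theta 1 r r :=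
  ramanujanTheta_X_pow r r

theorem theta_neg_one_zero (r : ℕ) : theta (-1) 0 r = 0 := by
  refine latticeSum_eq_zero (Equiv.subLeft 1) (fun k _ => ?_) fun k => ?_
  · have := two_mul_thetaExp (0 : ℕ) r (1 - k)
    have := two_mul_thetaExp (0 : ℕ) r k
    push_cast at *
    rw [Equiv.subLeft_apply]
    linarith
  · rw [Equiv.subLeft_apply, zpow_sub, zpow_one, ← zpow_neg,
      uzpow_eq_uzpow (-1) (k := -k) (l := k) ⟨-k, by ring⟩, neg_one_mul, Units.val_neg]

theorem theta_one_zero {r : ℕ} (hr : 0 < r) : theta 1 0 r = 2 * theta 1 r (3 * r) := by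
  have bijective : Function.Bijective fun x : Fin 2 × ℤ =>
      (![fun k => 2 * k, fun k => 1 - 2 * k] : Fin 2 → ℤ → ℤ) x.1 x.2 := by
    refine ⟨?_, fun k => ?_⟩
    · rintro ⟨a, k⟩ ⟨a', k'⟩ h
      fin_cases a <;> fin_cases a' <;> simp at h ⊢ <;> lia
    · rcases Int.even_or_odd' k with ⟨l, h | h⟩
      · exact ⟨(0, l), by simp; lia⟩
      · exact ⟨(1, -l), by simp; lia⟩
  rw [theta, latticeSum_eq_sum (latticeSummable_thetaExp (by lia) _) _ bijective, Fin.sum_univ_two,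
    two_mul]
  congr 1 <;> refine latticeSum_congr (fun k => by simp only [one_zpow]) fun k _ =>
    mul_left_cancel₀ two_ne_zero ?_
  · simp only [two_mul_thetaExp, Matrix.cons_val_zero]
    push_cast
    ring
  · simp only [two_mul_thetaExp, Matrix.cons_val_one, Matrix.cons_val_fin_one]
    push_cast
    ring

theorem two_mul_thetaPsi_X_pow {r : ℕ} (hr : 0 < r) : 2 * thetaPsi (X ^ r) = theta 1 0 r := by
  rw [theta_one_zero hr, thetaPsi, ← pow_mul, mul_comm r 3, ramanujanTheta_X_pow]

theorem theta_neg_one_self_mul_eulerE {r : ℕ} (hr : 0 < r) :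
    theta (-1) r r * eulerE (2 * r) = eulerE r ^ 2 := by
  rw [theta_neg_one_eq_prod (by lia), ← two_mul, ← qPoch_mul_eulerE hr]
  ring

theorem theta_neg_one_two_mul {r : ℕ} (hr : 0 < r) : theta (-1) r (2 * r) = eulerE r := by
  rw [theta_neg_one_eq_prod (by lia), eulerE, eulerE,
    qPoch_eq_prod_qPoch (X_dvd_X_pow hr) _ (m := 3) (by lia)]
  simp only [Finset.prod_range_succ, Finset.prod_range_zero, one_mul, ← pow_mul, ← pow_add]
  congr 3 <;> ring

theorem theta_one_zero_mul_eulerE {r : ℕ} (hr : 0 < r) :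
    theta 1 0 r * eulerE r = 2 * eulerE (2 * r) ^ 2 := by
  have h := qPoch_neg_mul_qPoch (X_dvd_X_pow hr) (X ^ r)
  rw [← pow_mul, mul_comm r 2] at h
  rw [theta_one_eq_prod (by lia), zero_add, pow_zero, qPoch_eq_one_sub_mul (X_dvd_X_pow hr) (-1),
    neg_one_mul, eulerE, eulerE, ← h]
  ring

theorem expand_latticeSum {R ι : Type*} [CommRing R] [TopologicalSpace R] [DiscreteTopology R]
    {w : ι → ℤ} {c : ι → R} (h : LatticeSummable w c) {m : ℕ} (hm : m ≠ 0) :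
    expand m hm (latticeSum w c) = latticeSum (fun i => m * w i) c := by
  have h' : LatticeSummable (fun i => m * w i) c :=
    ⟨fun i hi => mul_nonneg m.cast_nonneg (h.nonneg i hi), fun d => (h.finite d).subset
      fun i hi => ⟨hi.1, by nlinarith [hi.2, h.nonneg i hi.1, Nat.pos_of_ne_zero hm]⟩⟩
  have toNat (i : ι) (hi : c i ≠ 0) : (m * w i).toNat = m * (w i).toNat := by
    rw [Int.toNat_mul m.cast_nonneg (h.nonneg i hi), Int.toNat_natCast]
  ext d
  rw [coeff_latticeSum h', coeff_expand]
  split_ifs with hd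
  · obtain ⟨e, rfl⟩ := hd
    rw [Nat.mul_div_cancel_left _ (Nat.pos_of_ne_zero hm), coeff_latticeSum h]
    refine tsum_congr fun i => ?_
    by_cases hi : c i = 0
    · rw [hi, ite_self, ite_self]
    · simp only [toNat i hi, Nat.mul_right_inj hm]
  · refine (tsum_congr fun i => ?_).trans tsum_zero |>.symm
    by_cases hi : c i = 0
    · rw [hi, ite_self]
    · exact if_neg fun he : d = (m * w i).toNat => hd ⟨(w i).toNat, he.trans (toNat i hi)⟩

theorem expand_theta (s : ℤˣ) {i j : ℕ} (h : 0 < i + j) {m : ℕ} (hm : m ≠ 0) :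
    expand m hm (theta s i j) = theta s (m * i) (m * j) := by
  rw [theta, expand_latticeSum (latticeSummable_thetaExp h _), theta]
  refine latticeSum_congr (fun _ => rfl) fun k _ => ?_
  rw [thetaExp, thetaExp]
  push_cast
  ring

/-! ### Products of two theta functions -/

theorem neg_one_zpow_eq {k l : ℤ} (h : (k - l) % 2 = 0) : (-1 : ℤˣ) ^ k = (-1) ^ l :=
  uzpow_eq_uzpow _ (by lia)

theorem neg_one_zpow_eq_neg {k l : ℤ} (h : (k - l) % 2 = 1) : (-1 : ℤˣ) ^ k = -(-1) ^ l := by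
  rw [neg_one_zpow_eq (l := l + 1) (by lia), zpow_add, zpow_one, mul_neg_one]

section ThetaProducts

variable {i j i' j' : ℕ}

theorem theta_mul_theta (s t : ℤˣ) (h : 0 < i + j) (h' : 0 < i' + j') :
    theta s i j * theta t i' j' =
      latticeSum (fun x : ℤ × ℤ => thetaExp i j x.1 + thetaExp i' j' x.2)
        (fun x => ((s ^ x.1 * t ^ x.2 : ℤˣ) : ℤ)) := by
  simp only [theta, latticeSum_mul (latticeSummable_thetaExp h _) (latticeSummable_thetaExp h' _),
    Units.val_mul]

theorem latticeSummable_thetaExp_add_thetaExp (h : 0 < i + j) (h' : 0 < i' + j')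
    (c : ℤ × ℤ → ℤ) :
    LatticeSummable (fun x : ℤ × ℤ => thetaExp i j x.1 + thetaExp i' j' x.2) c :=
  ((latticeSummable_thetaExp h fun _ => 1).prod
    (latticeSummable_thetaExp h' fun _ => (1 : ℤ))).of_support fun _ _ => by norm_num

theorem unit_mul_X_pow_mul_theta_mul_theta (u : ℤˣ) (n : ℕ) (s t : ℤˣ) (h : 0 < i + j)
    (h' : 0 < i' + j') :
    C (u : ℤ) * X ^ n * (theta s i j * theta t i' j') =
      latticeSum (fun x : ℤ × ℤ => thetaExp i j x.1 + thetaExp i' j' x.2 + n)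
        (fun x => ((u * (s ^ x.1 * t ^ x.2) : ℤˣ) : ℤ)) := by
  simp only [theta_mul_theta s t h h',
    C_mul_X_pow_mul_latticeSum _ _ (latticeSummable_thetaExp_add_thetaExp h h' _), Units.val_mul]

end ThetaProducts

/-- The splitting of `ℤ²` by the parity of the coordinate sum. -/
def parityMap : Fin 2 → ℤ × ℤ → ℤ × ℤ :=
  ![fun y => (y.1 + y.2, y.1 - y.2), fun y => (1 - y.1 - y.2, y.2 - y.1)]

theorem bijective_parityMap :
    Function.Bijective fun x : Fin 2 × (ℤ × ℤ) => parityMap x.1 x.2 := by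
  constructor
  · rintro ⟨a, u, v⟩ ⟨a', u', v'⟩ h
    fin_cases a <;> fin_cases a' <;> simp [parityMap, Prod.ext_iff] at h ⊢ <;> lia
  · rintro ⟨m, n⟩
    rcases Int.even_or_odd' (m + n) with ⟨u, h | h⟩
    · exact ⟨(0, u, m - u), by simp [parityMap, Prod.ext_iff]; lia⟩
    · exact ⟨(1, -u, u + 1 - m), by simp [parityMap, Prod.ext_iff]; lia⟩

/-- Schröter's formula for the product `f(a, b) f(c, d)` with `a b = c d`. -/
theorem theta_mul_theta_of_add_eq_add (s t : ℤˣ) {i u v : ℕ} (h : 0 < 2 * i + u + v) :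
    theta s i (i + u + v) * theta t (i + v) (i + u) =
      theta (s * t) (2 * i + v) (2 * i + 2 * u + v) *
        theta (s * t) (2 * i + u) (2 * i + u + 2 * v) +
      C (s : ℤ) * X ^ i *
        (theta (s * t) u (4 * i + u + 2 * v) * theta (s * t) v (4 * i + 2 * u + v)) := by
  rw [unit_mul_X_pow_mul_theta_mul_theta _ _ _ _ (by lia) (by lia),
    theta_mul_theta _ _ (by lia) (by lia), theta_mul_theta _ _ (by lia) (by lia),
    latticeSum_eq_sum (latticeSummable_thetaExp_add_thetaExp (by lia) (by lia) _) _
      bijective_parityMap, Fin.sum_univ_two]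
  congr 1 <;> refine latticeSum_congr (fun x => congrArg Units.val ?_)
    (fun x _ => mul_left_cancel₀ two_ne_zero ?_)
  · simp only [parityMap, Matrix.cons_val_zero]
    rw [← zpow_add, mul_zpow, uzpow_eq_uzpow t (l := x.1 + x.2) ⟨-x.2, by ring⟩]
  · simp only [parityMap, Matrix.cons_val_zero, mul_add, two_mul_thetaExp]
    push_cast
    ring
  · simp only [parityMap, Matrix.cons_val_one, Matrix.cons_val_fin_one]
    rw [← zpow_add, mul_zpow, ← mul_assoc, ← zpow_one_add,
      uzpow_eq_uzpow s (l := 1 + (x.1 + x.2)) ⟨-x.1 - x.2, by ring⟩,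
      uzpow_eq_uzpow t (l := x.1 + x.2) ⟨-x.1, by ring⟩]
  · simp only [parityMap, Matrix.cons_val_one, Matrix.cons_val_fin_one, mul_add, two_mul_thetaExp]
    push_cast
    ring

theorem theta_one_four_mul_theta_neg_two_three :
    theta 1 1 4 * theta (-1) 2 3 =
      theta (-1) 3 7 * theta (-1) 4 6 + X * (theta (-1) 2 8 * theta (-1) 1 9) := by
  simpa using theta_mul_theta_of_add_eq_add 1 (-1) (i := 1) (u := 2) (v := 1) (by lia)

theorem theta_neg_one_four_mul_theta_two_three :
    theta (-1) 1 4 * theta 1 2 3 =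
      theta (-1) 3 7 * theta (-1) 4 6 - X * (theta (-1) 2 8 * theta (-1) 1 9) := by
  simpa [← sub_eq_add_neg] using
    theta_mul_theta_of_add_eq_add (-1) 1 (i := 1) (u := 2) (v := 1) (by lia)

theorem theta_neg_one_mul_theta_one {i j : ℕ} (hi : 0 < i) (hij : i ≤ j) :
    theta (-1) i j * theta 1 i j = theta (-1) (2 * i) (2 * j) * theta (-1) (i + j) (i + j) := by
  obtain ⟨u, rfl⟩ := Nat.exists_eq_add_of_le hij
  have h := theta_mul_theta_of_add_eq_add (-1) 1 (i := i) (u := u) (v := 0) (by lia)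
  simpa only [mul_one, add_zero, mul_zero, theta_neg_one_zero, mul_add, two_mul i,
    add_assoc] using h

/-- `φ(-q^r)² = φ(q^{2r})² - 4 q^r ψ(q^{4r})²`. -/
theorem theta_neg_one_self_sq {r : ℕ} (hr : 0 < r) :
    theta (-1) r r ^ 2 = theta 1 (2 * r) (2 * r) ^ 2 - X ^ r * theta 1 0 (4 * r) ^ 2 := by
  have h := theta_mul_theta_of_add_eq_add (-1) (-1) (i := r) (u := 0) (v := 0) (by lia)
  simp only [add_zero, mul_zero, Int.units_mul_self, Units.val_neg, Units.val_one, map_neg,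
    map_one] at h
  linear_combination h

/-- Multiplication by `2 + i` on `ℤ[i]`, and the four translates by a unit. -/
def gaussianMap : Fin 5 → ℤ × ℤ → ℤ × ℤ :=
  ![fun y => (2 * y.1 - y.2, y.1 + 2 * y.2), fun y => (1 - 2 * y.1 - y.2, 2 * y.2 - y.1),
    fun y => (y.1 - 2 * y.2, 1 - 2 * y.1 - y.2), fun y => (2 * y.1 + y.2 - 1, y.1 - 2 * y.2),
    fun y => (2 * y.2 - y.1, 2 * y.1 + y.2 - 1)]

theorem bijective_gaussianMap :
    Function.Bijective fun x : Fin 5 × (ℤ × ℤ) => gaussianMap x.1 x.2 := by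
  constructor
  · rintro ⟨a, u, v⟩ ⟨a', u', v'⟩ h
    fin_cases a <;> fin_cases a' <;> simp [gaussianMap, Prod.ext_iff] at h ⊢ <;> lia
  · rintro ⟨m, n⟩
    have residue : (m - 2 * n) % 5 = 0 ∨ (m - 2 * n) % 5 = 1 ∨ (m - 2 * n) % 5 = 3 ∨
      (m - 2 * n) % 5 = 4 ∨ (m - 2 * n) % 5 = 2 := by lia
    rcases residue with h | h | h | h | h
    · exact ⟨(0, (2 * m + n) / 5, (2 * n - m) / 5), by simp [gaussianMap, Prod.ext_iff]; lia⟩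
    · exact ⟨(1, (2 - 2 * m - n) / 5, (1 - m + 2 * n) / 5), by
        simp [gaussianMap, Prod.ext_iff]; lia⟩
    · exact ⟨(2, (2 - 2 * n + m) / 5, (1 - n - 2 * m) / 5), by
        simp [gaussianMap, Prod.ext_iff]; lia⟩
    · exact ⟨(3, (2 + 2 * m + n) / 5, (1 + m - 2 * n) / 5), by
        simp [gaussianMap, Prod.ext_iff]; lia⟩
    · exact ⟨(4, (2 + 2 * n - m) / 5, (1 + n + 2 * m) / 5), by
        simp [gaussianMap, Prod.ext_iff]; lia⟩

/-- `φ(-q^r)² = φ(-q^{5r})² - 4 q^r f(-q^r, -q^{9r}) f(-q^{3r}, -q^{7r})`. -/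
theorem theta_neg_one_self_sq_eq_sub {r : ℕ} (hr : 0 < r) :
    theta (-1) r r ^ 2 = theta (-1) (5 * r) (5 * r) ^ 2 -
      4 * (X ^ r * (theta (-1) r (9 * r) * theta (-1) (3 * r) (7 * r))) := by
  set w := fun x : ℤ × ℤ => thetaExp r r x.1 + thetaExp r r x.2
  set c := fun x : ℤ × ℤ => (((-1) ^ x.1 * (-1) ^ x.2 : ℤˣ) : ℤ)
  have identity_part : latticeSum (fun x => w (gaussianMap 0 x)) (fun x => c (gaussianMap 0 x)) =
      theta (-1) (5 * r) (5 * r) ^ 2 := by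
    rw [sq, theta_mul_theta _ _ (by lia) (by lia)]
    refine latticeSum_congr (fun x => ?_) (fun x _ => mul_left_cancel₀ two_ne_zero ?_)
    · simp only [c, ← zpow_add]
      exact congrArg Units.val (neg_one_zpow_eq (by simp [gaussianMap]; lia))
    · simp [w, gaussianMap, mul_add, two_mul_thetaExp]; ring
  have translate_part (a : Fin 4) : latticeSum (fun x => w (gaussianMap a.succ x))
      (fun x => c (gaussianMap a.succ x)) =
        C ((-1 : ℤˣ) : ℤ) * X ^ r * (theta (-1) r (9 * r) * theta (-1) (3 * r) (7 * r)) := by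
    rw [unit_mul_X_pow_mul_theta_mul_theta _ _ _ _ (by lia) (by lia)]
    refine latticeSum_congr (fun x => ?_) (fun x _ => mul_left_cancel₀ two_ne_zero ?_)
    · simp only [c, ← zpow_add, neg_one_mul]
      exact congrArg Units.val (neg_one_zpow_eq_neg (by fin_cases a <;> simp [gaussianMap] <;> lia))
    · fin_cases a <;> simp [w, gaussianMap, mul_add, two_mul_thetaExp] <;> ring
  rw [sq, theta_mul_theta _ _ (by lia) (by lia),
    latticeSum_eq_sum (latticeSummable_thetaExp_add_thetaExp (by lia) (by lia) _) _
      bijective_gaussianMap, Fin.sum_univ_succ, identity_part,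
    Finset.sum_congr rfl fun a _ => translate_part a, Finset.sum_const]
  simp
  ring

/-- Multiplication by `2 + i` on the points `(2m - 1) + (2n - 1)i`, and the four translates by a
unit. -/
def gaussianOddMap : Fin 5 → ℤ × ℤ → ℤ × ℤ :=
  ![fun y => (2 * y.1 - y.2, y.1 + 2 * y.2 - 1), fun y => (1 - 2 * y.1 + y.2, 1 - y.1 - 2 * y.2),
    fun y => (y.1 + 2 * y.2, 1 - 2 * y.1 + y.2), fun y => (2 * y.1 - y.2, y.1 + 2 * y.2),
    fun y => (1 - y.1 - 2 * y.2, 2 * y.1 - y.2)]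

theorem bijective_gaussianOddMap :
    Function.Bijective fun x : Fin 5 × (ℤ × ℤ) => gaussianOddMap x.1 x.2 := by
  constructor
  · rintro ⟨a, u, v⟩ ⟨a', u', v'⟩ h
    fin_cases a <;> fin_cases a' <;> simp [gaussianOddMap, Prod.ext_iff] at h ⊢ <;> lia
  · rintro ⟨m, n⟩
    have residue : (m - 2 * n) % 5 = 2 ∨ (m - 2 * n) % 5 = 4 ∨ (m - 2 * n) % 5 = 3 ∨
      (m - 2 * n) % 5 = 0 ∨ (m - 2 * n) % 5 = 1 := by lia
    rcases residue with h | h | h | h | h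
    · exact ⟨(0, (2 * m + n + 1) / 5, (2 * n - m + 2) / 5), by
        simp [gaussianOddMap, Prod.ext_iff]; lia⟩
    · exact ⟨(1, (3 - 2 * m - n) / 5, (1 + m - 2 * n) / 5), by
        simp [gaussianOddMap, Prod.ext_iff]; lia⟩
    · exact ⟨(2, (2 + m - 2 * n) / 5, (2 * m + n - 1) / 5), by
        simp [gaussianOddMap, Prod.ext_iff]; lia⟩
    · exact ⟨(3, (2 * m + n) / 5, (2 * n - m) / 5), by
        simp [gaussianOddMap, Prod.ext_iff]; lia⟩
    · exact ⟨(4, (1 - m + 2 * n) / 5, (2 - 2 * m - n) / 5), by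
        simp [gaussianOddMap, Prod.ext_iff]; lia⟩

/-- `ψ(q^r)² = q^r ψ(q^{5r})² + f(q^r, q^{4r}) f(q^{2r}, q^{3r})`. -/
theorem theta_one_zero_sq {r : ℕ} (hr : 0 < r) :
    theta 1 0 r ^ 2 = X ^ r * theta 1 0 (5 * r) ^ 2 +
      4 * (theta 1 r (4 * r) * theta 1 (2 * r) (3 * r)) := by
  set w := fun x : ℤ × ℤ => thetaExp (0 : ℕ) r x.1 + thetaExp (0 : ℕ) r x.2
  set c := fun x : ℤ × ℤ => ((1 ^ x.1 * 1 ^ x.2 : ℤˣ) : ℤ)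
  have identity_part : latticeSum (fun x => w (gaussianOddMap 0 x))
      (fun x => c (gaussianOddMap 0 x)) =
        C ((1 : ℤˣ) : ℤ) * X ^ r * (theta 1 0 (5 * r) * theta 1 0 (5 * r)) := by
    rw [unit_mul_X_pow_mul_theta_mul_theta _ _ _ _ (by lia) (by lia)]
    refine latticeSum_congr (fun x => ?_) (fun x _ => mul_left_cancel₀ two_ne_zero ?_)
    · simp only [c, one_zpow, mul_one]
    · simp [w, gaussianOddMap, mul_add, two_mul_thetaExp]; ring
  have translate_part (a : Fin 4) : latticeSum (fun x => w (gaussianOddMap a.succ x))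
      (fun x => c (gaussianOddMap a.succ x)) = theta 1 r (4 * r) * theta 1 (2 * r) (3 * r) := by
    rw [theta_mul_theta _ _ (by lia) (by lia)]
    refine latticeSum_congr (fun x => ?_) (fun x _ => mul_left_cancel₀ two_ne_zero ?_)
    · simp only [c, one_zpow]
    · fin_cases a <;> simp [w, gaussianOddMap, mul_add, two_mul_thetaExp] <;> ring
  rw [sq, theta_mul_theta _ _ (by lia) (by lia),
    latticeSum_eq_sum (latticeSummable_thetaExp_add_thetaExp (by lia) (by lia) _) _
      bijective_gaussianOddMap, Fin.sum_univ_succ, identity_part,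
    Finset.sum_congr rfl fun a _ => translate_part a, Finset.sum_const]
  simp
  ring

section LevelTwenty

/-- `((2k + y + 1)² + 5y² - 1) / 2` at `(y, k)`. -/
def normFiveExp (x : ℤ × ℤ) : ℤ :=
  3 * x.1 ^ 2 + x.1 * (2 * x.2 + 1) + 2 * x.2 ^ 2 + 2 * x.2

/-- The sum `∑ (-1)^y q^{((2k + y + 1)² + 5y² - 1) / 2}` over all `(y, k)`, which turns into
products of theta functions in two ways: by splitting modulo two and modulo three. -/
def normFiveSum : ℤ⟦X⟧ :=
  latticeSum normFiveExp fun x => (((-1) ^ x.1 : ℤˣ) : ℤ)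

theorem latticeSummable_normFiveExp (c : ℤ × ℤ → ℤ) : LatticeSummable normFiveExp c := by
  have two_mul (y k : ℤ) : 2 * normFiveExp (y, k) + 1 = (y + 2 * k + 1) ^ 2 + 5 * y ^ 2 := by
    rw [normFiveExp]
    ring
  refine .of_abs_le_prod 2 (fun x _ => ?_) fun y k _ => ?_
  · have := two_mul x.1 x.2
    have := sq_nonneg (x.1 + 2 * x.2 + 1)
    have := sq_nonneg x.1
    lia
  · have := two_mul y k
    have := Int.natAbs_le_self_sq y
    have := Int.natAbs_le_self_sq (y + 2 * k + 1)
    rw [Int.abs_eq_natAbs, Int.abs_eq_natAbs]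
    lia

/-- The splitting of `ℤ²` by the second coordinate modulo three. -/
def modThreeMap : Fin 3 → ℤ × ℤ → ℤ × ℤ :=
  ![fun y => (y.2 - y.1, -3 * y.2), fun y => (y.1, 3 * y.2 + 1), fun y => (y.1 - y.2, 3 * y.2 - 1)]

theorem bijective_modThreeMap :
    Function.Bijective fun x : Fin 3 × (ℤ × ℤ) => modThreeMap x.1 x.2 := by
  constructor
  · rintro ⟨a, u, v⟩ ⟨a', u', v'⟩ h
    fin_cases a <;> fin_cases a' <;> simp [modThreeMap, Prod.ext_iff] at h ⊢ <;> lia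
  · rintro ⟨m, n⟩
    have residue : n % 3 = 0 ∨ n % 3 = 1 ∨ n % 3 = 2 := by lia
    rcases residue with h | h | h
    · exact ⟨(0, -(n / 3) - m, -(n / 3)), by simp [modThreeMap, Prod.ext_iff]; lia⟩
    · exact ⟨(1, m, n / 3), by simp [modThreeMap, Prod.ext_iff]; lia⟩
    · exact ⟨(2, m + (n + 1) / 3, (n + 1) / 3), by simp [modThreeMap, Prod.ext_iff]; lia⟩

/-- The splitting of `ℤ²` by the parity of the first coordinate. -/
def modTwoMap : Fin 2 → ℤ × ℤ → ℤ × ℤ :=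
  ![fun y => (2 * y.2, y.1 - y.2 - 1), fun y => (2 * y.2 - 1, y.1 - y.2)]

theorem bijective_modTwoMap :
    Function.Bijective fun x : Fin 2 × (ℤ × ℤ) => modTwoMap x.1 x.2 := by
  constructor
  · rintro ⟨a, u, v⟩ ⟨a', u', v'⟩ h
    fin_cases a <;> fin_cases a' <;> simp [modTwoMap, Prod.ext_iff] at h ⊢ <;> lia
  · rintro ⟨m, n⟩
    rcases Int.even_or_odd' m with ⟨u, h | h⟩
    · exact ⟨(0, n + u + 1, u), by simp [modTwoMap, Prod.ext_iff]; lia⟩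
    · exact ⟨(1, n + u + 1, u + 1), by simp [modTwoMap, Prod.ext_iff]; lia⟩

theorem normFiveSum_eq_sub :
    normFiveSum = theta 1 0 4 * theta 1 10 10 - X ^ 2 * (theta 1 2 2 * theta 1 0 20) := by
  have neg_smul : -(X ^ 2 * (theta 1 2 2 * theta 1 0 20)) =
      C ((-1 : ℤˣ) : ℤ) * X ^ 2 * (theta 1 2 2 * theta 1 0 20) := by simp
  rw [normFiveSum, latticeSum_eq_sum (latticeSummable_normFiveExp _) _ bijective_modTwoMap,
    Fin.sum_univ_two, sub_eq_add_neg, neg_smul, theta_mul_theta _ _ (by lia) (by lia),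
    unit_mul_X_pow_mul_theta_mul_theta _ _ _ _ (by lia) (by lia)]
  congr 1 <;> refine latticeSum_congr (fun x => congrArg Units.val ?_)
    (fun x _ => mul_left_cancel₀ two_ne_zero ?_)
  · rw [one_zpow, one_zpow, mul_one, neg_one_zpow_eq (l := 0) (by simp [modTwoMap]), zpow_zero]
  · simp [mul_add, two_mul_thetaExp, normFiveExp, modTwoMap]; ring
  · rw [one_zpow, one_zpow, mul_one, mul_one, neg_one_zpow_eq_neg (l := 0) (by simp [modTwoMap]),
      zpow_zero]
  · simp [mul_add, two_mul_thetaExp, normFiveExp, modTwoMap]; ring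

theorem normFiveSum_eq_two_mul : normFiveSum = 2 * (theta (-1) 2 4 * theta (-1) 10 20) := by
  let term (a : Fin 3) := latticeSum (fun x => normFiveExp (modThreeMap a x))
    (fun x => (((-1) ^ (modThreeMap a x).1 : ℤˣ) : ℤ))
  have zero : term 0 = theta (-1) 2 4 * theta (-1) 10 20 := by
    rw [theta_mul_theta _ _ (by lia) (by lia)]
    refine latticeSum_congr (fun x => ?_) (fun x _ => mul_left_cancel₀ two_ne_zero ?_)
    · rw [← zpow_add]
      exact congrArg Units.val (neg_one_zpow_eq (by simp [modThreeMap]; lia))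
    · simp [mul_add, two_mul_thetaExp, normFiveExp, modThreeMap]; ring
  have one : term 1 = 0 := by
    let σ : ℤ × ℤ → ℤ × ℤ := fun x => (-x.1 - (2 * x.2 + 1), x.2)
    refine latticeSum_eq_zero ⟨σ, σ, fun x => by simp [σ], fun x => by simp [σ]⟩ (fun x _ => ?_)
      fun x => ?_
    · simp [σ, normFiveExp, modThreeMap]; ring
    · rw [← Units.val_neg]
      exact congrArg Units.val (neg_one_zpow_eq_neg (by simp [σ, modThreeMap]; lia))
  have two : term 2 = theta (-1) 2 4 * theta (-1) 10 20 := by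
    rw [theta_mul_theta _ _ (by lia) (by lia)]
    refine latticeSum_congr (fun x => ?_) (fun x _ => mul_left_cancel₀ two_ne_zero ?_)
    · rw [← zpow_add]
      exact congrArg Units.val (neg_one_zpow_eq (by simp [modThreeMap]; lia))
    · simp [mul_add, two_mul_thetaExp, normFiveExp, modThreeMap]; ring
  calc normFiveSum = term 0 + term 1 + term 2 :=
        (latticeSum_eq_sum (latticeSummable_normFiveExp _) _ bijective_modThreeMap).trans
          (Fin.sum_univ_three _)
    _ = 2 * (theta (-1) 2 4 * theta (-1) 10 20) := by rw [zero, one, two]; ring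

end LevelTwenty

/-- `ψ(q⁴) φ(q¹⁰) - q² φ(q²) ψ(q²⁰) = E₂ E₁₀`. -/
theorem theta_level_twenty :
    theta 1 0 4 * theta 1 10 10 - X ^ 2 * (theta 1 2 2 * theta 1 0 20) =
      2 * (theta (-1) 2 4 * theta (-1) 10 20) :=
  normFiveSum_eq_sub.symm.trans normFiveSum_eq_two_mul

/-! ### Jacobi's identity for the cube of the Euler product -/

section SquareZero

variable {A : Type*} [CommRing A] {e : A}

theorem one_add_pow_of_mul_self_eq_zero (he : e * e = 0) (n : ℕ) : (1 + e) ^ n = 1 + n * e := by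
  induction n with
  | zero => simp
  | succ n ih =>
    rw [pow_succ, ih]
    push_cast
    linear_combination n * he

theorem thetaMonomial_of_mul_self_eq_zero (he : e * e = 0) (s : ℕ) (k : ℤ) :
    thetaMonomial (-(C (1 + e) * X ^ s)) (-C (1 - e)) k =
      C ((((-1) ^ k : ℤˣ) : ℤ) * (1 + k * e)) * X ^ (thetaExp s (0 : ℕ) k).toNat := by
  obtain ⟨x, hx⟩ := Int.eq_ofNat_of_zero_le (half_mul_succ_nonneg k)
  obtain ⟨y, hy⟩ := Int.eq_ofNat_of_zero_le (half_mul_pred_nonneg k)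
  have hk : k = x - y := by
    have := two_mul_half_mul_succ k
    have := two_mul_half_mul_pred k
    linarith
  have sign : ((-1) ^ k : ℤˣ) = (-1) ^ (x + y) := by
    rw [← zpow_natCast]
    exact neg_one_zpow_eq (by lia)
  have coefficient : (1 + e) ^ x * (1 - e) ^ y = 1 + k * e := by
    rw [sub_eq_add_neg, one_add_pow_of_mul_self_eq_zero he,
      one_add_pow_of_mul_self_eq_zero (by rwa [neg_mul_neg]), hk]
    push_cast
    linear_combination -(x * y : A) * he
  rw [thetaMonomial, thetaExp, hx, hy, sign, ← coefficient, Nat.cast_zero, zero_mul, add_zero,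
    ← Nat.cast_mul, Int.toNat_natCast, Int.toNat_natCast, Int.toNat_natCast, neg_pow,
    neg_pow (C _), mul_pow]
  push_cast
  simp only [map_mul, map_pow, map_neg, map_one]
  ring

/-- At `a = -(1 + e) q`, `b = -(1 - e)` with `e² = 0` the triple product vanishes to first order. -/
theorem tripleProduct_of_mul_self_eq_zero [TopologicalSpace A] [T2Space A]
    [IsTopologicalRing A] (he : e * e = 0) {q : A⟦X⟧} (hq : X ∣ q) :
    (∏' k : ℕ, (1 + -(C (1 + e) * q) * q ^ k)) * (∏' k : ℕ, (1 + -C (1 - e) * q ^ k)) *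
        ∏' k : ℕ, (1 - q ^ (k + 1)) =
      C e * (∏' k : ℕ, (1 - q ^ (k + 1))) ^ 3 := by
  have shifted : Multipliable fun k : ℕ => 1 + -C (1 - e) * q ^ (k + 1) :=
    (multipliable_one_add_mul_pow hq (-C (1 - e) * q)).congr fun k => by ring
  have pair : (∏' k : ℕ, (1 + -(C (1 + e) * q) * q ^ k)) *
      (∏' k : ℕ, (1 + -C (1 - e) * q ^ (k + 1))) =
        (∏' k : ℕ, (1 - q ^ (k + 1))) * ∏' k : ℕ, (1 - q ^ (k + 1)) := by
    rw [← (multipliable_one_add_mul_pow hq _).tprod_mul shifted,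
      ← (multipliable_one_sub_pow_succ hq).tprod_mul (multipliable_one_sub_pow_succ hq)]
    refine tprod_congr fun k => ?_
    have hC : (C e * C e : A⟦X⟧) = 0 := by rw [← map_mul, he, map_zero]
    simp only [map_add, map_sub, map_one]
    linear_combination -(q * q ^ k) ^ 2 * hC
  have first : (1 : A⟦X⟧) + -C (1 - e) * q ^ 0 = C e := by simp
  rw [tprod_eq_zero_mul' (f := fun k : ℕ => 1 + -C (1 - e) * q ^ k) shifted, first]
  linear_combination (C e * ∏' k : ℕ, (1 - q ^ (k + 1))) * pair

end SquareZero

instance discreteTopology_dualNumber : DiscreteTopology (DualNumber ℤ) :=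
  inferInstanceAs (DiscreteTopology (ℤ × ℤ))

theorem continuous_map_powerSeries {R S : Type*} [CommRing R] [CommRing S] [TopologicalSpace R]
    [DiscreteTopology R] [TopologicalSpace S] (f : R →+* S) :
    Continuous (PowerSeries.map f) := by
  refine continuous_iff_continuousAt.mpr fun x => ?_
  rw [ContinuousAt, PowerSeries.WithPiTopology.tendsto_iff_coeff_tendsto]
  intro d
  simp only [coeff_map]
  exact (continuous_of_discreteTopology.tendsto _).comp
    ((PowerSeries.WithPiTopology.continuous_coeff R d).tendsto x)

theorem map_eulerE {S : Type*} [CommRing S] [TopologicalSpace S] [T2Space S]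
    (f : ℤ →+* S) {s : ℕ} (hs : 0 < s) :
    PowerSeries.map f (eulerE s) = ∏' k : ℕ, (1 - (X ^ s : S⟦X⟧) ^ (k + 1)) := by
  rw [eulerE, qPoch, (multipliable_one_sub_mul_pow (X_dvd_X_pow hs) _).map_tprod _
    (continuous_map_powerSeries f)]
  refine tprod_congr fun k => ?_
  simp only [map_sub, map_one, map_mul, map_pow, map_X, pow_succ']

theorem latticeSum_id_mul_sign {s : ℕ} (hs : 0 < s) :
    latticeSum (thetaExp s (0 : ℕ)) (fun k => k * (((-1) ^ k : ℤˣ) : ℤ)) = eulerE s ^ 3 := by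
  set ε : DualNumber ℤ := DualNumber.eps
  have hε : ε * ε = 0 := DualNumber.eps_mul_eps
  have hab : (-(C (1 + ε) * X ^ s)) * (-C (1 - ε)) = X ^ s := by
    have inverse : (C (1 + ε) * C (1 - ε) : (DualNumber ℤ)⟦X⟧) = 1 := by
      rw [← map_mul, show (1 + ε) * (1 - ε) = 1 by linear_combination -hε, map_one]
    linear_combination X ^ s * inverse
  have triple := hasSum_thetaMonomial (hab ▸ X_dvd_X_pow hs)
  rw [hab, tripleProduct_of_mul_self_eq_zero hε (X_dvd_X_pow hs),
    ← map_eulerE (Int.castRingHom _) hs, ← map_pow] at triple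
  ext d
  have infinitesimal : TrivSqZeroExt.sndHom ℤ ℤ (coeff d (C ε *
      PowerSeries.map (Int.castRingHom (DualNumber ℤ)) (eulerE s ^ 3))) =
        coeff d (eulerE s ^ 3) := by
    rw [coeff_C_mul, coeff_map]
    simp [ε]
  have coeff_sum := ((PowerSeries.WithPiTopology.hasSum_iff_hasSum_coeff _).mp triple d).map
    (TrivSqZeroExt.sndHom ℤ ℤ) continuous_of_discreteTopology
  rw [coeff_latticeSum (latticeSummable_thetaExp (by lia) _), ← infinitesimal,
    ← coeff_sum.tsum_eq]
  refine tsum_congr fun k => ?_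
  rw [Function.comp_apply, thetaMonomial_of_mul_self_eq_zero hε, coeff_C_mul, coeff_X_pow]
  split_ifs <;> simp [mul_comm, ε]

/-! ### Appell–Lerch sums as indefinite double series -/

/-- The sign `[0 ≤ i] - [n < 0]` of the terms of an indefinite double series, supported on the
quadrants `0 ≤ n, i` and `n, i < 0`. -/
def appellSign (n i : ℤ) : ℤ := (if 0 ≤ i then 1 else 0) - (if n < 0 then 1 else 0)

theorem nonneg_or_neg_of_appellSign_ne_zero {n i : ℤ} (h : appellSign n i ≠ 0) :
    (0 ≤ n ∧ 0 ≤ i) ∨ (n < 0 ∧ i < 0) := by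
  rw [appellSign] at h
  split_ifs at h <;> lia

theorem appellSign_congr {m n : ℤ} (h : m < 0 ↔ n < 0) (i : ℤ) :
    appellSign m i = appellSign n i := by
  simp only [appellSign, h]

theorem appellSign_sub_appellSign_sub_one (n i : ℤ) :
    appellSign n i - appellSign n (i - 1) = if i = 0 then 1 else 0 := by
  rw [appellSign, appellSign]
  split_ifs <;> lia

theorem eq_zero_of_periodic_of_neg {R : Type*} [Zero R] {f : ℤ → R} {m : ℤ} (hm : m ≠ 0)
    (hf : Function.Periodic f m) (hneg : ∀ l < 0, f l = 0) (l : ℤ) : f l = 0 := by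
  rw [← hf.int_mul (-(|l| + 1) * m.sign) l]
  refine hneg _ ?_
  have one_le_abs : 1 ≤ |m| := Int.one_le_abs hm
  rw [Int.cast_id, mul_assoc, Int.sign_mul_self_eq_abs]
  nlinarith [le_abs_self l, abs_nonneg l]

theorem coeff_inverse_one_sub_single_of_neg {m : ℤ} (hm : m ≠ 0) {l : ℤ} (hl : l < 0) :
    (Ring.inverse (1 - HahnSeries.single m (1 : ℤ)) : LaurentSeries ℤ).coeff l = 0 := by
  obtain ⟨unit, order_eq⟩ := isUnit_one_sub_single hm
  have order_add := HahnSeries.order_mul unit.ne_zero unit.ringInverse.ne_zero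
  rw [Ring.mul_inverse_cancel _ unit, HahnSeries.order_one, order_eq] at order_add
  exact HahnSeries.coeff_eq_zero_of_lt_order (by lia)

theorem coeff_inverse_one_sub_single_sub {m : ℤ} (hm : m ≠ 0) (l : ℤ) :
    (Ring.inverse (1 - HahnSeries.single m (1 : ℤ)) : LaurentSeries ℤ).coeff l -
        (Ring.inverse (1 - HahnSeries.single m (1 : ℤ)) : LaurentSeries ℤ).coeff (l - m) =
      if l = 0 then 1 else 0 := by
  have cancel := Ring.mul_inverse_cancel _ (isUnit_one_sub_single hm).1
  rw [sub_mul, one_mul] at cancel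
  have := congrArg (fun f => HahnSeries.coeff f l) cancel
  rw [HahnSeries.coeff_sub, HahnSeries.coeff_one, HahnSeries.coeff_single_mul, one_mul] at this
  rw [this]
  congr

theorem coeff_inverse_one_sub_single {m : ℤ} (hm : m ≠ 0) (l : ℤ) :
    (Ring.inverse (1 - HahnSeries.single m (1 : ℤ)) : LaurentSeries ℤ).coeff l =
      if m ∣ l then appellSign m (l / m) else 0 := by
  set V : LaurentSeries ℤ := Ring.inverse (1 - HahnSeries.single m (1 : ℤ)) with hV
  set g : ℤ → ℤ := fun l => if m ∣ l then appellSign m (l / m) else 0 with hg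
  have recursion (l : ℤ) : g l - g (l - m) = if l = 0 then 1 else 0 := by
    by_cases h : m ∣ l
    · obtain ⟨i, rfl⟩ := h
      simp only [hg, dvd_mul_right, if_true, hm, ← mul_sub_one, mul_eq_zero, false_or,
        Int.mul_ediv_cancel_left _ hm, appellSign_sub_appellSign_sub_one]
    · rw [if_neg (by rintro rfl; exact h (dvd_zero m))]
      simp only [hg, h, dvd_sub_self_right, if_false, sub_self]
  have periodic : Function.Periodic (fun l => V.coeff l - g l) m := fun l => by
    have hVl := coeff_inverse_one_sub_single_sub hm (l + m)
    have hgl := recursion (l + m)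
    rw [add_sub_cancel_right, ← hV] at hVl
    rw [add_sub_cancel_right] at hgl
    linarith
  refine sub_eq_zero.mp (eq_zero_of_periodic_of_neg hm periodic (fun l hl => ?_) l)
  rw [coeff_inverse_one_sub_single_of_neg hm hl, zero_sub, neg_eq_zero, hg]
  refine ite_eq_right_iff.mpr ?_
  rintro ⟨i, rfl⟩
  rw [Int.mul_ediv_cancel_left _ hm]
  by_contra sign_ne
  rcases nonneg_or_neg_of_appellSign_ne_zero sign_ne with ⟨hm', hi⟩ | ⟨hm', hi⟩ <;> nlinarith

/-- The coefficients `±(-1)ⁿ` of the indefinite double series of an Appell–Lerch sum. -/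
def appellCoeff (x : ℤ × ℤ) : ℤ := appellSign x.1 x.2 * (((-1) ^ x.1 : ℤˣ) : ℤ)

theorem nonneg_or_neg_of_appellCoeff_ne_zero {x : ℤ × ℤ} (h : appellCoeff x ≠ 0) :
    (0 ≤ x.1 ∧ 0 ≤ x.2) ∨ (x.1 < 0 ∧ x.2 < 0) :=
  nonneg_or_neg_of_appellSign_ne_zero (left_ne_zero_of_mul h)

/-- The indefinite quadratic exponent `p n(n+1)/2 + (p n + j) i`. -/
def appellExp (j p : ℤ) (x : ℤ × ℤ) : ℤ := p * (x.1 * (x.1 + 1) / 2) + (p * x.1 + j) * x.2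

section

variable {j p : ℕ} (hj : 0 < j) (hp : j < p)

include hj hp

theorem abs_le_appellExp_add {l : ℕ} (hl : l ≤ j) {x : ℤ × ℤ} (h : appellCoeff x ≠ 0) :
    |x.1| ≤ appellExp j p x + l * (x.1 + 1) ∧ |x.2| ≤ appellExp j p x + l * (x.1 + 1) := by
  obtain ⟨n, i⟩ := x
  zify at hj hp hl
  simp only [appellExp]
  rcases nonneg_or_neg_of_appellCoeff_ne_zero h with ⟨hn, hi⟩ | ⟨hn, hi⟩ <;> dsimp only at hn hi
  · have tri_ge : n ≤ n * (n + 1) / 2 := by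
      linarith [two_mul_half_mul_succ n, two_mul_half_mul_pred n, half_mul_pred_nonneg n]
    rw [abs_of_nonneg hn, abs_of_nonneg hi]
    constructor <;> nlinarith [mul_nonneg hn hi, mul_nonneg (mul_nonneg hn hi) (hj.trans hp).le,
      mul_nonneg (Int.natCast_nonneg l) hn]
  · obtain ⟨a, rfl⟩ : ∃ a, n = -1 - a := ⟨-1 - n, by ring⟩
    obtain ⟨b, rfl⟩ : ∃ b, i = -1 - b := ⟨-1 - i, by ring⟩
    have ha : 0 ≤ a := by lia
    have hb : 0 ≤ b := by lia
    rw [abs_of_neg hn, abs_of_neg hi]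
    have := mul_nonneg (hj.trans hp).le (half_mul_succ_nonneg (-1 - a))
    constructor <;> nlinarith [mul_nonneg (mul_nonneg ha hb) (hj.trans hp).le,
      mul_nonneg (sub_nonneg.mpr hl) ha, mul_nonneg (sub_nonneg.mpr (Int.add_one_le_of_lt hp)) ha,
      mul_nonneg (sub_nonneg.mpr (Int.add_one_le_of_lt hp)) hb]

theorem latticeSummable_appellExp_add {l : ℕ} (hl : l ≤ j) :
    LatticeSummable (fun x => appellExp j p x + l * (x.1 + 1)) appellCoeff :=
  .of_abs_le_prod 0 (fun _ h => (abs_nonneg _).trans (abs_le_appellExp_add hj hp hl h).1)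
    fun _ _ h => by simpa using abs_le_appellExp_add hj hp hl h

theorem latticeSummable_appellExp : LatticeSummable (appellExp j p) appellCoeff := by
  simpa using latticeSummable_appellExp_add hj hp (Nat.zero_le j)

theorem mul_add_neg_iff (n : ℤ) : p * n + j < 0 ↔ n < 0 := by
  zify at hj hp
  constructor <;> intro h <;> nlinarith

theorem mul_add_ne_zero (n : ℤ) : (p * n + j : ℤ) ≠ 0 := by
  zify at hj hp
  intro h
  obtain hn | hn := lt_or_ge n 0 <;> nlinarith

theorem coeff_appellLerchTerm (n d : ℤ) :
    (appellLerchTerm j p n).coeff d =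
      if p * n + j ∣ d - (p * (n * (n + 1) / 2) + j * n + j) then
        appellCoeff (n, (d - (p * (n * (n + 1) / 2) + j * n + j)) / (p * n + j))
      else 0 := by
  rw [appellLerchTerm, HahnSeries.coeff_single_mul,
    coeff_inverse_one_sub_single (mul_add_ne_zero hj hp n),
    appellSign_congr (mul_add_neg_iff hj hp n), mul_ite, mul_zero]
  exact if_congr Iff.rfl (mul_comm _ _) rfl

theorem tsum_appellCoeff_fiber (n : ℤ) (d : ℕ) :
    (∑' i, if d = (appellExp j p (n, i) + j * (n + 1)).toNat then appellCoeff (n, i) else 0) =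
      (appellLerchTerm j p n).coeff d := by
  have term_eq (i : ℤ) :
      (if d = (appellExp j p (n, i) + j * (n + 1)).toNat then appellCoeff (n, i) else 0) =
        if d - (p * (n * (n + 1) / 2) + j * n + j) = (p * n + j) * i then appellCoeff (n, i)
          else 0 := by
    by_cases h0 : appellCoeff (n, i) = 0
    · simp only [h0, ite_self]
    · have nonneg := (latticeSummable_appellExp_add hj hp le_rfl).nonneg _ h0
      refine if_congr ?_ rfl rfl
      simp only [appellExp] at nonneg ⊢
      constructor <;> intro h <;> lia
  simp only [term_eq, coeff_appellLerchTerm hj hp]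
  split_ifs with h
  · obtain ⟨i, hi⟩ := h
    rw [hi, Int.mul_ediv_cancel_left _ (mul_add_ne_zero hj hp n), tsum_eq_single i, if_pos rfl]
    exact fun i' hi' => if_neg fun h' => hi' (mul_left_cancel₀ (mul_add_ne_zero hj hp n) h').symm
  · rw [tsum_congr fun i => if_neg fun h' => h ⟨i, h'⟩, tsum_zero]

theorem appellLerchSum_eq :
    appellLerchSum j p = latticeSum (fun x => appellExp j p x + j * (x.1 + 1)) appellCoeff := by
  have summable := latticeSummable_appellExp_add hj hp le_rfl
  ext d
  rw [coeff_latticeSum summable, (summable.summable_coeff d).tsum_prod, appellLerchSum, coeff_mk,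
    ← tsum_eq_finsum (L := .unconditional ℤ)]
  · exact tsum_congr fun n => (tsum_appellCoeff_fiber hj hp n d).symm
  · refine (Set.finite_Icc (-(d : ℤ)) d).subset fun n hn => abs_le.mp (not_lt.mp fun lt => ?_)
    exact hn (appellLerchTerm_coeff_eq_zero hj hp lt)

end

/-! ### The product of the double series with a theta function -/

theorem latticeSum_eq_zero_of_shift {R ι : Type*} [CommRing R] [IsDomain R] [TopologicalSpace R]
    [DiscreteTopology R] {w : ι → ℤ} {c : ι → R} (h : LatticeSummable w c) (e : ι ≃ ι)
    {K L : ℕ} (hKL : L ≠ K) (hw : ∀ i, w (e i) + L = w i + K)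
    (hc : latticeSum (fun i => w i + K) (fun i => c (e i) - c i) = 0) : latticeSum w c = 0 := by
  have shifted : X ^ L * latticeSum w c = latticeSum (fun i => w i + K) fun i => c (e i) := by
    rw [X_pow_mul_latticeSum _ h, ← latticeSum_equiv e]
    simp only [hw]
  have shifted_summable : LatticeSummable (fun i => w i + K) fun i => c (e i) := by
    simpa only [hw] using (h.add_const L.cast_nonneg).comp_injective e.injective
  have product : (X ^ L - X ^ K : R⟦X⟧) * latticeSum w c = 0 := by
    rw [sub_mul, shifted, X_pow_mul_latticeSum _ h,
      ← latticeSum_sub shifted_summable (h.add_const K.cast_nonneg), hc]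
  refine (mul_eq_zero.mp product).resolve_left fun eq => ?_
  simpa [coeff_X_pow, hKL] using congrArg (coeff L) eq

section Graph

variable {R ι κ : Type*} [CommRing R] [DecidableEq κ] {w : ι × κ → ℤ} {c : ι → R} {l : ι → κ}

theorem LatticeSummable.graph (h : LatticeSummable (fun i => w (i, l i)) c) :
    LatticeSummable w fun x => if x.2 = l x.1 then c x.1 else 0 where
  nonneg := by
    rintro ⟨i, k⟩ hx
    obtain ⟨hk, hc⟩ := ite_ne_right_iff.mp hx
    obtain rfl : k = l i := hk
    exact h.nonneg i hc
  finite d := by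
    refine ((h.finite d).image fun i => (i, l i)).subset ?_
    rintro ⟨i, k⟩ ⟨hx, hd⟩
    obtain ⟨hk, hc⟩ := ite_ne_right_iff.mp hx
    obtain rfl : k = l i := hk
    exact ⟨i, ⟨hc, hd⟩, rfl⟩

theorem latticeSum_graph [TopologicalSpace R] (w : ι × κ → ℤ) (c : ι → R) (l : ι → κ) :
    latticeSum w (fun x => if x.2 = l x.1 then c x.1 else 0) =
      latticeSum (fun i => w (i, l i)) c := by
  have injective : Function.Injective fun i => (i, l i) := fun _ _ h => (Prod.ext_iff.mp h).1
  rw [latticeSum, ← injective.tsum_eq, latticeSum]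
  · simp only [if_true]
  · rintro ⟨i, k⟩ hx
    by_cases hk : k = l i
    · exact ⟨i, by rw [hk]⟩
    · simp [hk] at hx

end Graph

theorem latticeSummable_half_mul_succ {p : ℕ} (hp : 0 < p) (m : ℤ) {a : ℤ} (ha : 0 ≤ a)
    (c : ℤ → ℤ) : LatticeSummable (fun k => p * ((k - m) * (k - m + 1) / 2) + a) c := by
  have base := (latticeSummable_thetaExp (i := p) (j := 0) (by lia) fun k => c (k + m)).add_const ha
  simpa [thetaExp, Function.comp_def] using base.comp_injective (Equiv.subRight m).injective

theorem latticeSum_half_mul_succ_eq_zero (p m a l : ℤ) :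
    latticeSum (fun k => p * ((k - m) * (k - m + 1) / 2) + a)
      (fun k => (((-1) ^ (k + l) : ℤˣ) : ℤ)) = 0 := by
  refine latticeSum_eq_zero (Equiv.subLeft (2 * m - 1)) (fun k _ => ?_) fun k => ?_
  · rw [Equiv.subLeft_apply]
    ring_nf
  · rw [Equiv.subLeft_apply, ← Units.val_neg]
    exact congrArg Units.val (neg_one_zpow_eq_neg (by lia))

/-- The shear `(k, (n, i)) ↦ ((n - i, i), k - i)`. -/
def appellShear : ℤ × (ℤ × ℤ) ≃ (ℤ × ℤ) × ℤ where
  toFun x := ((x.2.1 - x.2.2, x.2.2), x.1 - x.2.2)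
  invFun y := (y.2 + y.1.2, (y.1.1 + y.1.2, y.1.2))
  left_inv x := by simp
  right_inv y := by simp

/-- The exponent of the product of the double series with `θ(-q^j, -q^{p-j})` on the fibre over
`k` of the shear. -/
def shearExp (j p k : ℤ) (x : ℤ × ℤ) : ℤ :=
  p * (x.1 * (x.1 + 1) / 2 + k * (k - 1) / 2 - k * x.2) + j * k

/-- The coefficients on the fibre over `k` of the shear. -/
def shearCoeff (k : ℤ) (x : ℤ × ℤ) : ℤ :=
  appellSign (x.1 - x.2) x.2 * (((-1) ^ (x.1 + k) : ℤˣ) : ℤ)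

theorem appellExp_add_thetaExp_shear (j p : ℤ) (x : ℤ × (ℤ × ℤ)) :
    appellExp j p (appellShear x).1 + thetaExp j (p - j) (appellShear x).2 =
      shearExp j p x.1 x.2 := by
  obtain ⟨k, n, i⟩ := x
  refine mul_left_cancel₀ (two_ne_zero (α := ℤ)) ?_
  rw [mul_add, two_mul_thetaExp]
  simp only [appellExp, shearExp, appellShear, Equiv.coe_fn_mk]
  linear_combination p * (two_mul_half_mul_succ (n - i) - two_mul_half_mul_succ n
    - two_mul_half_mul_pred k)

theorem appellCoeff_mul_shear (x : ℤ × (ℤ × ℤ)) :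
    appellCoeff (appellShear x).1 * (((-1) ^ (appellShear x).2 : ℤˣ) : ℤ) =
      shearCoeff x.1 x.2 := by
  simp only [appellCoeff, shearCoeff, appellShear, Equiv.coe_fn_mk]
  rw [mul_assoc, ← Units.val_mul, ← zpow_add, neg_one_zpow_eq (l := x.2.1 + x.1) (by lia)]

theorem shearCoeff_succ_sub (k : ℤ) (x : ℤ × ℤ) :
    shearCoeff k (x.1, x.2 + 1) - shearCoeff k x =
      (if x.2 = -1 then (((-1) ^ (x.1 + k) : ℤˣ) : ℤ) else 0) -
        if x.2 = x.1 then (((-1) ^ (x.1 + k) : ℤˣ) : ℤ) else 0 := by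
  simp only [shearCoeff, appellSign]
  generalize (((-1) ^ (x.1 + k) : ℤˣ) : ℤ) = u
  split_ifs <;> lia

theorem hasSum_appellSign_sub (n : ℤ) : HasSum (fun i => appellSign (n - i) i) (n + 1) := by
  have step (n i : ℤ) :
      appellSign (n + 1 - i) i = appellSign (n - i) i + if i = n + 1 then 1 else 0 := by
    rw [appellSign, appellSign]
    split_ifs <;> lia
  induction n using Int.inductionOn' (b := -1) with
  | zero =>
    refine (hasSum_zero (α := ℤ) (β := ℤ)).congr_fun fun i => ?_
    rw [appellSign]
    split_ifs <;> lia
  | succ n _ ih => exact (ih.add (hasSum_ite_eq (n + 1) (1 : ℤ))).congr_fun (step n)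
  | pred n _ ih =>
    have difference := ih.sub (hasSum_ite_eq n (1 : ℤ))
    rw [add_sub_right_comm] at difference
    refine difference.congr_fun fun i => ?_
    rw [eq_sub_iff_add_eq]
    simpa using (step (n - 1) i).symm

theorem latticeSum_shear_zero {j p : ℕ} (hp : 0 < p)
    (h : LatticeSummable (shearExp j p 0) (shearCoeff 0)) :
    latticeSum (shearExp j p 0) (shearCoeff 0) = eulerE p ^ 3 := by
  have fiber (n : ℤ) : latticeSum (fun i => shearExp j p 0 (n, i)) (fun i => shearCoeff 0 (n, i)) =
      C (n * (((-1) ^ n : ℤˣ) : ℤ) + (((-1) ^ n : ℤˣ) : ℤ)) *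
        X ^ (thetaExp p (0 : ℕ) n).toNat := by
    have total := (((hasSum_appellSign_sub n).map C
      PowerSeries.WithPiTopology.continuous_C).mul_right
      (C (((-1) ^ n : ℤˣ) : ℤ) * X ^ (thetaExp p (0 : ℕ) n).toNat)).tsum_eq
    rw [← add_one_mul, map_mul, mul_assoc, ← total, latticeSum]
    refine tsum_congr fun i => ?_
    rw [shearCoeff, shearExp, thetaExp]
    simp [mul_assoc]
  have theta_zero : latticeSum (thetaExp p (0 : ℕ)) (fun k => (((-1) ^ k : ℤˣ) : ℤ)) = 0 := by
    refine Eq.trans ?_ (latticeSum_half_mul_succ_eq_zero p 0 0 0)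
    exact latticeSum_congr (fun k => by rw [add_zero]) fun k _ => by simp [thetaExp]
  rw [latticeSum_prod h, tsum_congr fiber, ← latticeSum, latticeSum_add
    (latticeSummable_thetaExp (by lia) _) (latticeSummable_thetaExp (by lia) _),
    latticeSum_id_mul_sign hp, theta_zero, add_zero]

section

variable {j p : ℕ} (hj : 0 < j) (hp : j < p)

include hj hp

theorem latticeSummable_shear :
    LatticeSummable (fun x : ℤ × (ℤ × ℤ) => shearExp j p x.1 x.2)
      (fun x => shearCoeff x.1 x.2) := by
  have := ((latticeSummable_appellExp hj hp).prod (latticeSummable_thetaExp (i := j) (j := p - j)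
    (by lia) fun k => (((-1) ^ k : ℤˣ) : ℤ))).comp_injective appellShear.injective
  simpa only [Nat.cast_sub hp.le, appellExp_add_thetaExp_shear, appellCoeff_mul_shear] using this

theorem latticeSummable_shearExp (k : ℤ) :
    LatticeSummable (shearExp j p k) (shearCoeff k) :=
  (latticeSummable_shear hj hp).comp_injective (g := fun x : ℤ × ℤ => (k, x))
    fun _ _ h => (Prod.ext_iff.mp h).2

/-- The difference is supported on the two lines `i = -1` and `i = n`, on each of which the
reflection of the triangular exponent in `n` reverses the sign. -/
theorem latticeSum_shearCoeff_succ_sub {k a : ℤ} (ha : 0 ≤ j * k + a) :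
    latticeSum (fun x => shearExp j p k x + a)
      (fun x => shearCoeff k (x.1, x.2 + 1) - shearCoeff k x) = 0 := by
  have bottom (n : ℤ) : shearExp j p k (n, -1) + a =
      p * ((n - 0) * (n - 0 + 1) / 2) + (p * (k * (k + 1) / 2) + (j * k + a)) := by
    have half : k * (k - 1) / 2 + k = k * (k + 1) / 2 := by
      linarith [two_mul_half_mul_pred k, two_mul_half_mul_succ k]
    simp only [shearExp, sub_zero]
    linear_combination p * half
  have diagonal (n : ℤ) : shearExp j p k (n, n) + a =
      p * ((n - k) * (n - k + 1) / 2) + (j * k + a) := by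
    have half : n * (n + 1) / 2 + k * (k - 1) / 2 - k * n = (n - k) * (n - k + 1) / 2 := by
      linarith [two_mul_half_mul_pred k, two_mul_half_mul_succ n, two_mul_half_mul_succ (n - k)]
    simp only [shearExp]
    linear_combination p * half
  have hp0 : 0 < p := by lia
  have ha' : 0 ≤ p * (k * (k + 1) / 2) + (j * k + a) :=
    add_nonneg (mul_nonneg p.cast_nonneg (half_mul_succ_nonneg k)) ha
  simp only [shearCoeff_succ_sub]
  rw [latticeSum_sub (.graph (c := fun n => (((-1) ^ (n + k) : ℤˣ) : ℤ)) (l := fun _ => -1) ?_)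
      (.graph (c := fun n => (((-1) ^ (n + k) : ℤˣ) : ℤ)) (l := fun n => n) ?_),
    latticeSum_graph _ (fun n => (((-1) ^ (n + k) : ℤˣ) : ℤ)) fun _ => -1,
    latticeSum_graph _ (fun n => (((-1) ^ (n + k) : ℤˣ) : ℤ)) fun n => n]
  · simp only [bottom, diagonal]
    rw [latticeSum_half_mul_succ_eq_zero, latticeSum_half_mul_succ_eq_zero, sub_zero]
  · simpa only [bottom] using latticeSummable_half_mul_succ hp0 0 ha' _
  · simpa only [diagonal] using latticeSummable_half_mul_succ hp0 k ha _

theorem latticeSum_shear_eq_zero {k : ℤ} (hk : k ≠ 0) :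
    latticeSum (shearExp j p k) (shearCoeff k) = 0 := by
  obtain ⟨K, hK⟩ := Int.eq_ofNat_of_zero_le (show 0 ≤ p * |k| by positivity)
  obtain ⟨L, hL⟩ := Int.eq_ofNat_of_zero_le (show 0 ≤ p * (|k| + k) from
    mul_nonneg p.cast_nonneg (by linarith [neg_abs_le k]))
  refine latticeSum_eq_zero_of_shift (latticeSummable_shearExp hj hp k)
    ((Equiv.refl ℤ).prodCongr (Equiv.addRight 1)) (K := K) (L := L) ?_ (fun x => ?_)
    (latticeSum_shearCoeff_succ_sub hj hp ?_)
  · have := mul_ne_zero (show (p : ℤ) ≠ 0 by lia) hk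
    lia
  · simp only [shearExp, Equiv.prodCongr_apply, Prod.map, Equiv.refl_apply, Equiv.coe_addRight]
    linear_combination hK - hL
  · rw [← hK]
    zify at hp
    nlinarith [abs_nonneg k, neg_abs_le k]

theorem latticeSum_appell_mul_theta :
    latticeSum (appellExp j p) appellCoeff * theta (-1) j (p - j) = eulerE p ^ 3 := by
  rw [theta, latticeSum_mul (latticeSummable_appellExp hj hp)
    (latticeSummable_thetaExp (by lia) _), ← latticeSum_equiv appellShear]
  simp only [Nat.cast_sub hp.le, appellExp_add_thetaExp_shear, appellCoeff_mul_shear]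
  rw [latticeSum_prod (latticeSummable_shear hj hp),
    tsum_eq_single 0 fun k hk => latticeSum_shear_eq_zero hj hp hk,
    latticeSum_shear_zero (hj.trans hp) (latticeSummable_shearExp hj hp 0)]

end

/-! ### The odd part of the generating function -/

section OddPart

variable {R : Type*} [CommRing R]

/-- The power series whose `n`-th coefficient is the coefficient of index `2n + 1` of `f`. -/
def oddPart (f : R⟦X⟧) : R⟦X⟧ := PowerSeries.mk fun n => coeff (2 * n + 1) f

theorem oddPart_eq_iff {f g : R⟦X⟧} :
    oddPart f = g ↔ ∃ h, f = expand 2 two_ne_zero h + X * expand 2 two_ne_zero g := by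
  constructor
  · rintro rfl
    refine ⟨PowerSeries.mk fun n => coeff (2 * n) f, ?_⟩
    ext d
    rw [map_add]
    obtain ⟨m, rfl | rfl⟩ := Nat.even_or_odd' d
    · rw [coeff_expand_mul, coeff_mk]
      cases m with
      | zero => simp
      | succ m =>
        rw [mul_add_one, coeff_succ_X_mul, coeff_expand_of_not_dvd _ _ _ (by lia), add_zero]
    · rw [coeff_succ_X_mul, coeff_expand_mul, coeff_expand_of_not_dvd _ _ _ (by lia), zero_add,
        oddPart, coeff_mk]
  · rintro ⟨h, rfl⟩
    ext n
    rw [oddPart, coeff_mk, map_add, coeff_succ_X_mul, coeff_expand_mul,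
      coeff_expand_of_not_dvd _ _ _ (by lia), zero_add]

theorem oddPart_mul_expand (f g : R⟦X⟧) :
    oddPart (f * expand 2 two_ne_zero g) = oddPart f * g := by
  obtain ⟨h, hf⟩ := oddPart_eq_iff.mp (rfl : oddPart f = oddPart f)
  refine oddPart_eq_iff.mpr ⟨h * g, ?_⟩
  rw [map_mul, map_mul]
  linear_combination expand 2 two_ne_zero g * hf

variable {ι κ : Type*} {w : ι → ℤ} {c : ι → R} {v : κ → ℤ} {g : κ → ι}

theorem LatticeSummable.of_two_mul_add_one (h : LatticeSummable w c) (hg : Function.Injective g)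
    (hw : ∀ k, w (g k) = 2 * v k + 1) : LatticeSummable v fun k => c (g k) where
  nonneg k hk := by
    have := h.nonneg (g k) hk
    have := hw k
    lia
  finite d := ((h.comp_injective hg).finite (2 * d + 1)).subset fun k hk =>
    ⟨hk.1, by linarith [hw k, hk.2]⟩

theorem oddPart_latticeSum [TopologicalSpace R] [DiscreteTopology R] (h : LatticeSummable w c)
    (hg : Function.Injective g) (hw : ∀ k, w (g k) = 2 * v k + 1)
    (hodd : ∀ i, w i % 2 = 1 → i ∈ Set.range g) :
    oddPart (latticeSum w c) = latticeSum v fun k => c (g k) := by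
  ext d
  rw [oddPart, coeff_mk, coeff_latticeSum h, coeff_latticeSum (h.of_two_mul_add_one hg hw),
    ← hg.tsum_eq]
  · refine tsum_congr fun k => ?_
    by_cases hk : c (g k) = 0
    · simp only [hk, ite_self]
    · have := h.nonneg _ hk
      have := hw k
      exact if_congr (by lia) rfl rfl
  · intro i hi
    obtain ⟨hd, hc⟩ := ite_ne_right_iff.mp hi
    have := h.nonneg i hc
    exact hodd i (by lia)

end OddPart

/-- The parametrization `(s, (n, u)) ↦ ((n, s + 2u), s - n)` of the triples `((n, i), m)` with
`i - m - n` even, which index the odd powers of `q` in the product of an Appell–Lerch sum with a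
theta function. -/
def oddIndex (x : ℤ × (ℤ × ℤ)) : (ℤ × ℤ) × ℤ := ((x.2.1, x.1 + 2 * x.2.2), x.1 - x.2.1)

theorem oddIndex_injective : Function.Injective oddIndex := by
  rintro ⟨s, n, u⟩ ⟨s', n', u'⟩ eq
  simp only [oddIndex, Prod.mk.injEq] at eq ⊢
  lia

/-- Half of the exponent of `oddIndex x`, up to a constant. -/
def oddExp (j r : ℤ) (x : ℤ × (ℤ × ℤ)) : ℤ := thetaExp j (r - j) x.1 + appellExp j (2 * r) x.2

theorem appellExp_add_thetaExp_oddIndex (j r : ℤ) (x : ℤ × (ℤ × ℤ)) :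
    appellExp j (2 * r) (oddIndex x).1 + j * ((oddIndex x).1.1 + 1) +
        thetaExp j (2 * r - j) (oddIndex x).2 =
      2 * oddExp j r x + j := by
  obtain ⟨s, n, u⟩ := x
  refine mul_left_cancel₀ (two_ne_zero (α := ℤ)) ?_
  rw [mul_add 2 _ (thetaExp _ _ _), two_mul_thetaExp, oddExp, mul_add 2 (thetaExp _ _ _),
    two_mul_thetaExp]
  simp only [appellExp, oddIndex]
  linear_combination -2 * r * two_mul_half_mul_succ n

theorem mem_range_oddIndex {h r : ℤ} {x : (ℤ × ℤ) × ℤ}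
    (hx : (appellExp (2 * h + 1) (2 * r) x.1 + (2 * h + 1) * (x.1.1 + 1) +
      thetaExp (2 * h + 1) (2 * r - (2 * h + 1)) x.2) % 2 = 1) : x ∈ Set.range oddIndex := by
  obtain ⟨⟨n, i⟩, m⟩ := x
  obtain ⟨u, hu | hu⟩ := Int.even_or_odd' (i - m - n)
  · exact ⟨(m + n, n, u), by simp only [oddIndex, Prod.mk.injEq]; lia⟩
  · obtain rfl : i = m + n + 2 * u + 1 := by lia
    have parity := appellExp_add_thetaExp_oddIndex (2 * h + 1) r (m + n, n, u)
    simp only [oddIndex, appellExp, add_sub_cancel_right] at parity hx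
    generalize n * (n + 1) / 2 = t at parity hx
    lia

section

variable {j r : ℕ} (hj : 0 < j) (hr : j ≤ r)

include hj hr

theorem latticeSummable_oddExp :
    LatticeSummable (oddExp j r) (fun x => appellCoeff x.2) := by
  have := (latticeSummable_thetaExp (i := j) (j := r - j) (by lia) fun _ => (1 : ℤ)).prod
    (latticeSummable_appellExp (p := 2 * r) hj (by lia))
  push_cast [Nat.cast_sub hr] at this
  simp only [one_mul] at this
  exact this

theorem theta_one_mul_latticeSum_appell :
    theta 1 j (r - j) * latticeSum (appellExp j (2 * r : ℕ)) appellCoeff =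
      latticeSum (oddExp j r) fun x => appellCoeff x.2 := by
  rw [theta, latticeSum_mul (latticeSummable_thetaExp (by lia) _)
    (latticeSummable_appellExp hj (by lia))]
  push_cast [Nat.cast_sub hr]
  simp only [one_zpow, Units.val_one, one_mul]
  rfl

end

/-- The involution `n ↦ -(n + 1 + 2u)`, which preserves `oddExp`. -/
def oddReflection : Equiv.Perm (ℤ × (ℤ × ℤ)) where
  toFun x := (x.1, (-(x.2.1 + 1 + 2 * x.2.2), x.2.2))
  invFun x := (x.1, (-(x.2.1 + 1 + 2 * x.2.2), x.2.2))
  left_inv x := Prod.ext rfl (Prod.ext (by dsimp only; ring) rfl)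
  right_inv x := Prod.ext rfl (Prod.ext (by dsimp only; ring) rfl)

theorem oddExp_oddReflection (j r : ℤ) (x : ℤ × (ℤ × ℤ)) :
    oddExp j r (oddReflection x) = oddExp j r x := by
  obtain ⟨s, n, u⟩ := x
  simp only [oddExp, appellExp, oddReflection, Equiv.coe_fn_mk]
  linear_combination r * (two_mul_half_mul_succ (-(n + 1 + 2 * u)) - two_mul_half_mul_succ n)

theorem appellSign_sub_appellSign (n i i' : ℤ) :
    appellSign n i - appellSign n i' = (if 0 ≤ i then 1 else 0) - (if 0 ≤ i' then 1 else 0) :=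
  sub_sub_sub_cancel_right _ _ _

/-- Both differences are `(-1)^n` times a sign that does not depend on `n`. -/
theorem appellCoeff_oddIndex_sub_oddReflection (x : ℤ × (ℤ × ℤ)) :
    appellCoeff (oddIndex (oddReflection x)).1 - appellCoeff (oddReflection x).2 =
      -(appellCoeff (oddIndex x).1 - appellCoeff x.2) := by
  obtain ⟨s, n, u⟩ := x
  simp only [appellCoeff, oddIndex, oddReflection, Equiv.coe_fn_mk, ← sub_mul,
    appellSign_sub_appellSign]
  rw [neg_one_zpow_eq_neg (k := -(n + 1 + 2 * u)) (l := n) (by lia), Units.val_neg, mul_neg]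

section

variable {h r : ℕ} (hr : 2 * h + 1 ≤ r)

include hr

theorem latticeSummable_appell_theta :
    LatticeSummable (fun x : (ℤ × ℤ) × ℤ => appellExp (2 * h + 1) (2 * r) x.1 +
        (2 * h + 1) * (x.1.1 + 1) + thetaExp (2 * h + 1) (2 * r - (2 * h + 1)) x.2)
      (fun x => appellCoeff x.1) := by
  have := (latticeSummable_appellExp_add (j := 2 * h + 1) (p := 2 * r) (by lia) (by lia)
    le_rfl).prod (latticeSummable_thetaExp (i := 2 * h + 1) (j := 2 * r - (2 * h + 1)) (by lia)
      fun _ => (1 : ℤ))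
  push_cast [Nat.cast_sub (show 2 * h + 1 ≤ 2 * r by lia)] at this
  simpa only [mul_one] using this

theorem latticeSummable_oddExp_oddIndex :
    LatticeSummable (fun x => oddExp (2 * h + 1) r x + h) fun x => appellCoeff (oddIndex x).1 :=
  (latticeSummable_appell_theta hr).of_two_mul_add_one oddIndex_injective fun x => by
    rw [appellExp_add_thetaExp_oddIndex]
    ring

theorem oddPart_appellLerchSum_mul_theta :
    oddPart (appellLerchSum (2 * h + 1) (2 * r) * theta 1 (2 * h + 1) (2 * r - (2 * h + 1))) =
      latticeSum (fun x => oddExp (2 * h + 1) r x + h) fun x => appellCoeff (oddIndex x).1 := by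
  have hj : 0 < 2 * h + 1 := by lia
  have hp : 2 * h + 1 < 2 * r := by lia
  rw [appellLerchSum_eq hj hp, theta, latticeSum_mul (latticeSummable_appellExp_add hj hp le_rfl)
    (latticeSummable_thetaExp (by lia) _), Nat.cast_sub hp.le]
  push_cast
  simp only [one_zpow, Units.val_one, mul_one]
  refine oddPart_latticeSum (latticeSummable_appell_theta hr) oddIndex_injective (fun x => ?_)
    fun x => mem_range_oddIndex
  rw [appellExp_add_thetaExp_oddIndex]
  ring

theorem latticeSum_oddExp_oddIndex :
    latticeSum (fun x => oddExp (2 * h + 1) r x + h) (fun x => appellCoeff (oddIndex x).1) =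
      X ^ h * (theta 1 (2 * h + 1) (r - (2 * h + 1)) *
        latticeSum (appellExp (2 * h + 1 : ℕ) (2 * r : ℕ)) appellCoeff) := by
  have hj : 0 < 2 * h + 1 := by lia
  have summable := latticeSummable_oddExp hj hr
  rw [theta_one_mul_latticeSum_appell hj hr, X_pow_mul_latticeSum _ summable, ← sub_eq_zero]
  push_cast at summable ⊢
  rw [← latticeSum_sub (latticeSummable_oddExp_oddIndex hr) (summable.add_const h.cast_nonneg)]
  exact latticeSum_eq_zero oddReflection (fun x _ => by rw [oddExp_oddReflection])
    appellCoeff_oddIndex_sub_oddReflection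

end

section Units

theorem constantCoeff_qPoch {a q : ℤ⟦X⟧} (ha : X ∣ a) (hq : X ∣ q) :
    constantCoeff (qPoch a q) = 1 := by
  rw [qPoch, (multipliable_one_sub_mul_pow hq a).map_tprod _
    (PowerSeries.WithPiTopology.continuous_constantCoeff ℤ)]
  simp [X_dvd_iff.mp ha]

theorem constantCoeff_eulerE {r : ℕ} (hr : 0 < r) : constantCoeff (eulerE r) = 1 :=
  constantCoeff_qPoch (X_dvd_X_pow hr) (X_dvd_X_pow hr)

variable {i j : ℕ} (hi : 0 < i) (hj : 0 < j)

include hi hj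

theorem constantCoeff_theta_neg_one : constantCoeff (theta (-1) i j) = 1 := by
  have hij : X ∣ (X ^ (i + j) : ℤ⟦X⟧) := X_dvd_X_pow (by lia)
  rw [theta_neg_one_eq_prod (by lia), map_mul, map_mul, constantCoeff_qPoch (X_dvd_X_pow hi) hij,
    constantCoeff_qPoch (X_dvd_X_pow hj) hij, constantCoeff_eulerE (by lia), mul_one, mul_one]

end Units

theorem isUnit_of_constantCoeff_eq_one {R : Type*} [CommRing R] {f : R⟦X⟧}
    (h : constantCoeff f = 1) : IsUnit f := by
  rw [isUnit_iff_constantCoeff, h]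
  exact isUnit_one

theorem appellLerchGen_mul_theta {j p : ℕ} (hj : 0 < j) (hp : j < p) :
    appellLerchGen j p * theta (-1) j (p - j) = appellLerchSum j p := by
  have unit := isUnit_of_constantCoeff_eq_one (constantCoeff_theta_neg_one hj
    (Nat.sub_pos_of_lt hp))
  have product := theta_neg_one_eq_prod (i := j) (j := p - j) (by lia)
  rw [Nat.add_sub_cancel' hp.le, eulerE] at product
  rw [appellLerchGen, ← product, mul_right_comm, Ring.inverse_mul_cancel _ unit, one_mul]

theorem oddPart_appellLerchGen {h r : ℕ} (hr : 2 * h + 1 ≤ r) :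
    oddPart (appellLerchGen (2 * h + 1) (2 * r)) *
        (theta (-1) (2 * h + 1) (2 * r - (2 * h + 1)) * theta (-1) r r) =
      X ^ h * (theta 1 (2 * h + 1) (r - (2 * h + 1)) *
        latticeSum (appellExp (2 * h + 1 : ℕ) (2 * r : ℕ)) appellCoeff) := by
  rw [← latticeSum_oddExp_oddIndex hr, ← oddPart_appellLerchSum_mul_theta hr,
    ← appellLerchGen_mul_theta (by lia) (by lia), mul_assoc (appellLerchGen _ _),
    theta_neg_one_mul_theta_one (by lia) (by lia), ← oddPart_mul_expand, map_mul,
    expand_theta _ (by lia), expand_theta _ (by lia), Nat.add_sub_cancel' (by lia)]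

/-! ### Theta products modulo ten -/

/-- The product `(q ^ i, q ^ (10 - i); q ^ 10)_∞`. Every eta quotient and theta value below is a
monomial in `tenPair 1`, `tenPair 2`, `tenPair 3`, `tenPair 4`, `qPoch (X ^ 5) (X ^ 10)` and
`eulerE 10`. -/
def tenPair (i : ℕ) : ℤ⟦X⟧ := qPoch (X ^ i) (X ^ 10) * qPoch (X ^ (10 - i)) (X ^ 10)

theorem eulerE_five : eulerE 5 = qPoch (X ^ 5) (X ^ 10) * eulerE 10 :=
  (qPoch_mul_eulerE (by norm_num)).symm

theorem eulerE_two : eulerE 2 = tenPair 2 * tenPair 4 * eulerE 10 := by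
  rw [eulerE, qPoch_eq_prod_qPoch (X_dvd_X_pow two_pos) _ (m := 5) (by norm_num)]
  simp only [Finset.prod_range_succ, Finset.prod_range_zero, ← pow_mul, ← pow_add, eulerE, tenPair,
    Nat.reduceMul, Nat.reduceAdd, Nat.reduceSub]
  ring

theorem eulerE_one : eulerE 1 = tenPair 1 * tenPair 2 * tenPair 3 * tenPair 4 *
    qPoch (X ^ 5) (X ^ 10) * eulerE 10 := by
  rw [eulerE, qPoch_eq_prod_qPoch (X_dvd_X_pow one_pos) _ (m := 10) (by norm_num)]
  simp only [Finset.prod_range_succ, Finset.prod_range_zero, ← pow_mul, ← pow_add, eulerE, tenPair,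
    Nat.reduceMul, Nat.reduceAdd, Nat.reduceSub]
  ring

theorem theta_neg_one_five_five : theta (-1) 5 5 = qPoch (X ^ 5) (X ^ 10) ^ 2 * eulerE 10 := by
  rw [theta_neg_one_eq_prod (by norm_num), pow_two]

theorem qPoch_X_pow_five (i : ℕ) :
    qPoch (X ^ i) (X ^ 5) = qPoch (X ^ i) (X ^ 10) * qPoch (X ^ (i + 5)) (X ^ 10) := by
  rw [qPoch_eq_prod_qPoch (X_dvd_X_pow (by norm_num)) _ (m := 2) (by norm_num)]
  simp only [Finset.prod_range_succ, Finset.prod_range_zero, one_mul, ← pow_mul, ← pow_add,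
    Nat.reduceMul, add_zero]

section ThetaValues

variable {i j : ℕ}

theorem theta_neg_one_of_add_eq_ten (h : i + j = 10) :
    theta (-1) i j = tenPair i * eulerE 10 := by
  rw [theta_neg_one_eq_prod (by lia), h, tenPair, show 10 - i = j by lia]

theorem theta_neg_one_of_add_eq_five (h : i + j = 5) :
    theta (-1) i j = tenPair i * tenPair j * (qPoch (X ^ 5) (X ^ 10) * eulerE 10) := by
  rw [theta_neg_one_eq_prod (by lia), h, eulerE_five, qPoch_X_pow_five, qPoch_X_pow_five, tenPair,
    tenPair, show 10 - i = j + 5 by lia, show 10 - j = i + 5 by lia]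
  ring

theorem theta_one_of_add_eq_five (h : i + j = 5) :
    theta 1 i j * (tenPair i * tenPair j) =
      tenPair (2 * i) * (qPoch (X ^ 5) (X ^ 10) * eulerE 10) := by
  have qPoch_double (k : ℕ) :
      qPoch (-X ^ k) (X ^ 5) * (qPoch (X ^ k) (X ^ 10) * qPoch (X ^ (k + 5)) (X ^ 10)) =
        qPoch (X ^ (2 * k)) (X ^ 10) := by
    rw [← qPoch_X_pow_five, qPoch_neg_mul_qPoch (X_dvd_X_pow (by norm_num)), ← pow_mul, ← pow_mul,
      mul_comm k]
  rw [theta_one_eq_prod (by lia), h, eulerE_five, tenPair, tenPair, tenPair,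
    show 10 - i = j + 5 by lia, show 10 - j = i + 5 by lia, show 10 - 2 * i = 2 * j by lia,
    ← qPoch_double i, ← qPoch_double j]
  ring

theorem constantCoeff_tenPair (hi : 0 < i) (hi' : i < 10) : constantCoeff (tenPair i) = 1 := by
  rw [tenPair, map_mul, constantCoeff_qPoch, constantCoeff_qPoch, mul_one] <;>
    exact X_dvd_X_pow (by lia)

theorem constantCoeff_qPoch_five_ten : constantCoeff (qPoch (X ^ 5) (X ^ 10)) = 1 :=
  constantCoeff_qPoch (X_dvd_X_pow (by norm_num)) (X_dvd_X_pow (by norm_num))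

theorem tenPair_ne_zero (hi : 0 < i) (hi' : i < 10) : tenPair i ≠ 0 :=
  (isUnit_of_constantCoeff_eq_one (constantCoeff_tenPair hi hi')).ne_zero

theorem eulerE_ne_zero (hi : 0 < i) : eulerE i ≠ 0 :=
  (isUnit_of_constantCoeff_eq_one (constantCoeff_eulerE hi)).ne_zero

end ThetaValues

theorem qPoch_five_ten_ne_zero : qPoch (X ^ 5) (X ^ 10) ≠ 0 :=
  (isUnit_of_constantCoeff_eq_one constantCoeff_qPoch_five_ten).ne_zero

theorem tenPair_two_sq_mul : tenPair 2 ^ 2 * tenPair 3 * qPoch (X ^ 5) (X ^ 10) ^ 2 =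
    tenPair 1 * tenPair 4 * (tenPair 3 * tenPair 4 + X * (tenPair 1 * tenPair 2)) := by
  have theta_product := theta_one_four_mul_theta_neg_two_three
  rw [theta_neg_one_of_add_eq_five (by norm_num : 2 + 3 = 5),
    theta_neg_one_of_add_eq_ten (by norm_num : 3 + 7 = 10),
    theta_neg_one_of_add_eq_ten (by norm_num : 4 + 6 = 10),
    theta_neg_one_of_add_eq_ten (by norm_num : 2 + 8 = 10),
    theta_neg_one_of_add_eq_ten (by norm_num : 1 + 9 = 10)] at theta_product
  refine mul_left_cancel₀ (pow_ne_zero 2 (eulerE_ne_zero (i := 10) (by norm_num))) ?_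
  linear_combination tenPair 1 * tenPair 4 * theta_product - tenPair 2 * tenPair 3 *
    qPoch (X ^ 5) (X ^ 10) * eulerE 10 * theta_one_of_add_eq_five (by norm_num : 1 + 4 = 5)

theorem tenPair_one_mul_four_sq : tenPair 1 * tenPair 4 ^ 2 * qPoch (X ^ 5) (X ^ 10) ^ 2 =
    tenPair 2 * tenPair 3 * (tenPair 3 * tenPair 4 - X * (tenPair 1 * tenPair 2)) := by
  have theta_product := theta_neg_one_four_mul_theta_two_three
  rw [theta_neg_one_of_add_eq_five (by norm_num : 1 + 4 = 5),
    theta_neg_one_of_add_eq_ten (by norm_num : 3 + 7 = 10),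
    theta_neg_one_of_add_eq_ten (by norm_num : 4 + 6 = 10),
    theta_neg_one_of_add_eq_ten (by norm_num : 2 + 8 = 10),
    theta_neg_one_of_add_eq_ten (by norm_num : 1 + 9 = 10)] at theta_product
  refine mul_left_cancel₀ (pow_ne_zero 2 (eulerE_ne_zero (i := 10) (by norm_num))) ?_
  linear_combination tenPair 2 * tenPair 3 * theta_product - tenPair 1 * tenPair 4 *
    qPoch (X ^ 5) (X ^ 10) * eulerE 10 * theta_one_of_add_eq_five (by norm_num : 2 + 3 = 5)

theorem tenPair_sq_sub_sq : tenPair 2 * tenPair 4 * qPoch (X ^ 5) (X ^ 10) ^ 4 =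
    (tenPair 3 * tenPair 4) ^ 2 - X ^ 2 * (tenPair 1 * tenPair 2) ^ 2 := by
  have factor_ne_zero : tenPair 1 * tenPair 4 * (tenPair 2 * tenPair 3) ≠ 0 := by
    simp [tenPair_ne_zero]
  refine mul_left_cancel₀ factor_ne_zero ?_
  linear_combination
    tenPair 1 * tenPair 4 ^ 2 * qPoch (X ^ 5) (X ^ 10) ^ 2 * tenPair_two_sq_mul +
    tenPair 1 * tenPair 4 * (tenPair 3 * tenPair 4 + X * (tenPair 1 * tenPair 2)) *
      tenPair_one_mul_four_sq

theorem theta_one_zero_one_mul :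
    theta 1 0 1 * (tenPair 1 * tenPair 3 * qPoch (X ^ 5) (X ^ 10)) =
      2 * (tenPair 2 * tenPair 4 * eulerE 10) := by
  have factor_ne_zero : tenPair 2 * tenPair 4 * eulerE 10 ≠ 0 := by
    simp [tenPair_ne_zero, eulerE_ne_zero]
  have product := theta_one_zero_mul_eulerE one_pos
  rw [mul_one, eulerE_one, eulerE_two] at product
  refine mul_left_cancel₀ factor_ne_zero ?_
  linear_combination product

theorem theta_one_zero_five_mul : theta 1 0 5 * qPoch (X ^ 5) (X ^ 10) = 2 * eulerE 10 := by
  have product := theta_one_zero_mul_eulerE (r := 5) (by norm_num)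
  rw [eulerE_five] at product
  refine mul_left_cancel₀ (eulerE_ne_zero (i := 10) (by norm_num)) ?_
  linear_combination product

instance charZero_powerSeries {R : Type*} [Semiring R] [CharZero R] : CharZero R⟦X⟧ :=
  charZero_of_injective_ringHom C_injective

theorem tenPair_two_mul_four_sq : (tenPair 2 * tenPair 4) ^ 2 = tenPair 1 * tenPair 3 *
    (qPoch (X ^ 5) (X ^ 10) ^ 4 + X * (tenPair 1 * tenPair 3)) := by
  have psi_sq := theta_one_zero_sq one_pos
  have theta_one_four := theta_one_of_add_eq_five (by norm_num : 1 + 4 = 5)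
  have theta_two_three := theta_one_of_add_eq_five (by norm_num : 2 + 3 = 5)
  have psi_one := theta_one_zero_one_mul
  have psi_five := theta_one_zero_five_mul
  simp only [pow_one, Nat.reduceMul] at psi_sq theta_one_four theta_two_three
  have factor_ne_zero : 4 * eulerE 10 ^ 2 * (tenPair 2 * tenPair 4) ≠ 0 := by
    simp [tenPair_ne_zero, eulerE_ne_zero]
  refine mul_left_cancel₀ factor_ne_zero ?_
  generalize tenPair 1 = a, tenPair 2 = b, tenPair 3 = c, tenPair 4 = d,
    qPoch (X ^ 5) (X ^ 10) = e, eulerE 10 = J at *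
  linear_combination b * d * (a * c * e) ^ 2 * psi_sq -
    b * d * (theta 1 0 1 * (a * c * e) + 2 * (b * d * J)) * psi_one +
    b * d * X * (a * c) ^ 2 * (theta 1 0 5 * e + 2 * J) * psi_five +
    4 * a * c * e ^ 2 * (theta 1 2 3 * (b * c)) * theta_one_four +
    4 * a * c * e ^ 2 * (b * (e * J)) * theta_two_three

theorem theta_neg_one_one_one : theta (-1) 1 1 =
    tenPair 1 ^ 2 * tenPair 2 * tenPair 3 ^ 2 * tenPair 4 * qPoch (X ^ 5) (X ^ 10) ^ 2 *
      eulerE 10 := by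
  refine mul_right_cancel₀ (eulerE_ne_zero (i := 2) two_pos) ?_
  have square := theta_neg_one_self_mul_eulerE one_pos
  rw [mul_one, eulerE_one] at square
  rw [square, eulerE_two]
  ring

theorem tenPair_one_pow_mul : tenPair 1 ^ 4 * tenPair 2 ^ 2 * tenPair 3 ^ 4 * tenPair 4 ^ 2 *
    qPoch (X ^ 5) (X ^ 10) ^ 4 =
      qPoch (X ^ 5) (X ^ 10) ^ 4 - 4 * X * (tenPair 1 * tenPair 3) := by
  have phi_sq := theta_neg_one_self_sq_eq_sub one_pos
  simp only [mul_one, pow_one] at phi_sq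
  rw [theta_neg_one_one_one, theta_neg_one_five_five,
    theta_neg_one_of_add_eq_ten (by norm_num : 1 + 9 = 10),
    theta_neg_one_of_add_eq_ten (by norm_num : 3 + 7 = 10)] at phi_sq
  refine mul_left_cancel₀ (pow_ne_zero 2 (eulerE_ne_zero (i := 10) (by norm_num))) ?_
  linear_combination phi_sq

/-! ### The generating function of the odd-indexed coefficients -/

/-- The combination of theta functions in the generating function of the odd-indexed
coefficients. -/
def phiPsi : ℤ⟦X⟧ :=
  thetaPhi (X ^ 2) * thetaPhi (X ^ 10) - 4 * X ^ 3 * thetaPsi (X ^ 4) * thetaPsi (X ^ 20)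

theorem theta_neg_one_self_sq_eq_thetaPhi_sq_sub {r : ℕ} (hr : 0 < r) :
    theta (-1) r r ^ 2 = thetaPhi (X ^ (2 * r)) ^ 2 - 4 * X ^ r * thetaPsi (X ^ (4 * r)) ^ 2 := by
  rw [theta_neg_one_self_sq hr, thetaPhi_X_pow, ← two_mul_thetaPsi_X_pow (by lia)]
  ring

theorem thetaPsi_mul_thetaPhi_sub :
    thetaPsi (X ^ 4) * thetaPhi (X ^ 10) - X ^ 2 * (thetaPhi (X ^ 2) * thetaPsi (X ^ 20)) =
      tenPair 2 * tenPair 4 * eulerE 10 ^ 2 := by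
  have level_twenty := theta_level_twenty
  rw [theta_neg_one_two_mul (r := 2) two_pos, theta_neg_one_two_mul (r := 10) (by norm_num),
    ← two_mul_thetaPsi_X_pow (by norm_num), ← two_mul_thetaPsi_X_pow (by norm_num),
    ← thetaPhi_X_pow, ← thetaPhi_X_pow, eulerE_two] at level_twenty
  refine mul_left_cancel₀ (two_ne_zero (α := ℤ⟦X⟧)) ?_
  linear_combination level_twenty

/- Brahmagupta's identity for the form `x ^ 2 - 4 * q * y ^ 2`:
`(p p' - 4 q ^ 3 s s') ^ 2 = (p ^ 2 - 4 q s ^ 2) (p' ^ 2 - 4 q ^ 5 s' ^ 2)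
  + 4 q (s p' - q ^ 2 p s') ^ 2`. -/
theorem phiPsi_sq :
    phiPsi ^ 2 = eulerE 10 ^ 4 * (qPoch (X ^ 5) (X ^ 10) ^ 8 -
      4 * X * (tenPair 1 * tenPair 3) * qPoch (X ^ 5) (X ^ 10) ^ 4 +
        4 * X * (tenPair 2 * tenPair 4) ^ 2) := by
  have norm_one := theta_neg_one_self_sq_eq_thetaPhi_sq_sub one_pos
  have norm_five := theta_neg_one_self_sq_eq_thetaPhi_sq_sub (r := 5) (by norm_num)
  have level_twenty := thetaPsi_mul_thetaPhi_sub
  have phi_sq := tenPair_one_pow_mul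
  rw [theta_neg_one_one_one] at norm_one
  rw [theta_neg_one_five_five] at norm_five
  simp only [phiPsi, Nat.reduceMul, mul_one, pow_one] at norm_one norm_five ⊢
  generalize tenPair 1 = a, tenPair 2 = b, tenPair 3 = c, tenPair 4 = d,
    qPoch (X ^ 5) (X ^ 10) = e, eulerE 10 = J, thetaPhi (X ^ 2) = p, thetaPhi (X ^ 10) = p',
    thetaPsi (X ^ 4) = s, thetaPsi (X ^ 20) = s' at *
  linear_combination (-(e ^ 4 * J ^ 2)) * norm_one - (p ^ 2 - 4 * X * s ^ 2) * norm_five +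
    4 * X * (s * p' - X ^ 2 * (p * s') + b * d * J ^ 2) * level_twenty + J ^ 4 * e ^ 4 * phi_sq

theorem tenPair_mul_phiPsi_sq : (tenPair 2 * tenPair 4 * phiPsi) ^ 2 =
    (eulerE 10 ^ 2 *
      ((tenPair 3 * tenPair 4) ^ 2 + X ^ 2 * (tenPair 1 * tenPair 2) ^ 2)) ^ 2 := by
  linear_combination (tenPair 2 * tenPair 4) ^ 2 * phiPsi_sq +
    eulerE 10 ^ 4 * (4 * X * (tenPair 2 * tenPair 4) ^ 2 * tenPair_two_mul_four_sq +
      (tenPair 2 * tenPair 4 * qPoch (X ^ 5) (X ^ 10) ^ 4 +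
        ((tenPair 3 * tenPair 4) ^ 2 - X ^ 2 * (tenPair 1 * tenPair 2) ^ 2)) * tenPair_sq_sub_sq)

theorem constantCoeff_thetaPhi_X_pow {r : ℕ} (hr : 0 < r) :
    constantCoeff (thetaPhi (X ^ r)) = 1 := by
  rw [thetaPhi_X_pow, theta_one_eq_prod (by lia), map_mul, map_mul, constantCoeff_eulerE (by lia),
    constantCoeff_qPoch ((X_dvd_X_pow hr).neg_right) (X_dvd_X_pow (by lia)), mul_one, mul_one]

theorem tenPair_mul_phiPsi : tenPair 2 * tenPair 4 * phiPsi =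
    eulerE 10 ^ 2 * ((tenPair 3 * tenPair 4) ^ 2 + X ^ 2 * (tenPair 1 * tenPair 2) ^ 2) := by
  refine (sq_eq_sq_iff_eq_or_eq_neg.mp tenPair_mul_phiPsi_sq).resolve_right fun eq_neg => ?_
  have one_eq_neg_one := congrArg constantCoeff eq_neg
  simp [phiPsi, constantCoeff_tenPair, constantCoeff_eulerE, constantCoeff_thetaPhi_X_pow]
    at one_eq_neg_one

theorem oddPart_appellLerchGen_mul_tenPair : oddPart (appellLerchGen 1 10) *
    (tenPair 1 ^ 3 * tenPair 4 * qPoch (X ^ 5) (X ^ 10)) = tenPair 2 * eulerE 10 := by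
  have odd_part := oddPart_appellLerchGen (h := 0) (r := 5) (by norm_num)
  have triple_product := latticeSum_appell_mul_theta (j := 1) (p := 10) one_pos (by norm_num)
  simp only [Nat.reduceMul, Nat.reduceAdd, Nat.reduceSub, pow_zero, one_mul] at *
  rw [theta_neg_one_of_add_eq_ten (by norm_num : 1 + 9 = 10)] at odd_part triple_product
  rw [theta_neg_one_five_five] at odd_part
  have factor_ne_zero : eulerE 10 ^ 3 * qPoch (X ^ 5) (X ^ 10) ≠ 0 :=
    mul_ne_zero (pow_ne_zero 3 (eulerE_ne_zero (by norm_num))) qPoch_five_ten_ne_zero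
  refine mul_left_cancel₀ factor_ne_zero ?_
  linear_combination tenPair 1 ^ 2 * tenPair 4 * eulerE 10 * odd_part +
    theta 1 1 4 * tenPair 1 * tenPair 4 * triple_product +
    eulerE 10 ^ 3 * theta_one_of_add_eq_five (by norm_num : 1 + 4 = 5)

theorem eulerE_mul_oddPart_appellLerchGen :
    eulerE 1 ^ 2 * eulerE 5 ^ 2 * (2 * oddPart (appellLerchGen 1 10)) =
      eulerE 1 ^ 4 * eulerE 5 + 6 * X * (eulerE 2 * eulerE 10 ^ 3) * eulerE 1 +
        eulerE 2 ^ 2 * eulerE 5 * phiPsi := by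
  refine mul_left_cancel₀ (tenPair_ne_zero one_pos (by norm_num)) ?_
  have odd_part := oddPart_appellLerchGen_mul_tenPair
  have phi_psi := tenPair_mul_phiPsi
  have sum_relation := tenPair_two_sq_mul
  have phi_sq := tenPair_one_pow_mul
  have difference_relation := tenPair_sq_sub_sq
  rw [eulerE_one, eulerE_five, eulerE_two]
  generalize tenPair 1 = a, tenPair 2 = b, tenPair 3 = c, tenPair 4 = d,
    qPoch (X ^ 5) (X ^ 10) = e, eulerE 10 = J, oddPart (appellLerchGen 1 10) = U at *
  linear_combination 2 * b ^ 2 * c ^ 2 * d * e ^ 3 * J ^ 4 * odd_part -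
    a * b ^ 2 * d ^ 2 * e * J ^ 5 * phi_sq - a * b * d * e * J ^ 3 * phi_psi +
    2 * b * c * d * e * J ^ 5 * sum_relation - a * b * d * e * J ^ 5 * difference_relation

theorem two_mul_oddPart_appellLerchGen :
    2 * oddPart (appellLerchGen 1 10) =
      eulerE 1 ^ 2 * Ring.inverse (eulerE 5) +
      6 * X * (eulerE 2 * eulerE 10 ^ 3) * Ring.inverse (eulerE 1 * eulerE 5 ^ 2) +
      eulerE 2 ^ 2 * Ring.inverse (eulerE 1 ^ 2 * eulerE 5) * phiPsi := by
  have unit_one := isUnit_of_constantCoeff_eq_one (constantCoeff_eulerE one_pos)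
  have unit_five := isUnit_of_constantCoeff_eq_one (constantCoeff_eulerE (r := 5) (by norm_num))
  have inverse_five := Ring.mul_inverse_cancel _ unit_five
  have inverse_one_five_sq := Ring.mul_inverse_cancel _ (unit_one.mul (unit_five.pow 2))
  have inverse_one_sq_five := Ring.mul_inverse_cancel _ ((unit_one.pow 2).mul unit_five)
  refine mul_left_cancel₀ ((unit_one.pow 2).mul (unit_five.pow 2)).ne_zero ?_
  rw [eulerE_mul_oddPart_appellLerchGen]
  linear_combination (-(eulerE 1 ^ 4 * eulerE 5)) * inverse_five -
    6 * X * (eulerE 2 * eulerE 10 ^ 3) * eulerE 1 * inverse_one_five_sq -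
    eulerE 2 ^ 2 * eulerE 5 * phiPsi * inverse_one_sq_five

/-! ### The congruence modulo five -/

section EulerDerivation

variable (R : Type*) [CommRing R]

/-- The derivation `X * d/dX` of formal power series. It multiplies the coefficient of `X ^ n`
by `n`, so the image of `D - m` has vanishing coefficients at the exponents congruent to `m`
modulo the characteristic. -/
def eulerDerivation : Derivation R R⟦X⟧ R⟦X⟧ := (X : R⟦X⟧) • d⁄dX R

variable {R}

theorem eulerDerivation_apply (f : R⟦X⟧) : eulerDerivation R f = X * d⁄dX R f := rfl

theorem coeff_eulerDerivation (f : R⟦X⟧) (n : ℕ) :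
    coeff n (eulerDerivation R f) = n * coeff n f := by
  rw [eulerDerivation_apply]
  rcases n with _ | n
  · simp
  · rw [coeff_succ_X_mul, coeff_derivative]
    push_cast
    ring

theorem eulerDerivation_X : eulerDerivation R X = X := by
  rw [eulerDerivation_apply, derivative_X, mul_one]

variable (p : ℕ) [CharP R p]

theorem eulerDerivation_expand (hp : p ≠ 0) (f : R⟦X⟧) :
    eulerDerivation R (expand p hp f) = 0 := by
  ext n
  rw [coeff_eulerDerivation, map_zero]
  by_cases hn : p ∣ n
  · rw [(CharP.cast_eq_zero_iff R p n).mpr hn, zero_mul]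
  · rw [coeff_expand_of_not_dvd p hp f hn, mul_zero]

theorem coeff_eq_zero_of_eulerDerivation_sub_eq {G U : R⟦X⟧} {m : ℕ}
    (h : eulerDerivation R G - m * G = U) (n : ℕ) : coeff (p * n + m) U = 0 := by
  rw [← h, map_sub, coeff_eulerDerivation, ← nsmul_eq_mul m, map_nsmul, nsmul_eq_mul]
  simp

theorem eulerDerivation_map_eulerE (hp : p ≠ 0) {r : ℕ} (hr : 0 < r) :
    eulerDerivation R (map (Int.castRingHom R) (eulerE (p * r))) = 0 := by
  have eulerE_eq_expand : eulerE (p * r) = expand p hp (eulerE r) := by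
    rw [← theta_neg_one_two_mul hr, ← theta_neg_one_two_mul (by positivity),
      expand_theta _ (by lia), mul_left_comm]
  rw [eulerE_eq_expand, map_expand, eulerDerivation_expand]

end EulerDerivation

section RamanujanParameter

variable {A : Type*} [CommRing A] [IsDomain A]

/- With `x = q` and the products modulo ten for `a`, `b`, `c`, `d`, `e`, the elements `k` and
`x * r ^ 5` are Ramanujan's parameter `k = R(q) R(q ^ 2) ^ 2` and `R(q) ^ 5`, where `R` is the
Rogers-Ramanujan continued fraction. -/
theorem ramanujan_parameter_relation {a b c d e x k r : A} (hb : b ≠ 0) (hc : c ≠ 0) (hd : d ≠ 0)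
    (hk : x * (a * b) = c * d * k) (hr : a * d = b * c * r)
    (sum_relation : b ^ 2 * e ^ 2 = a * d ^ 2 * (1 + k))
    (difference_relation : a * d * e ^ 2 = b * c ^ 2 * (1 - k)) :
    x * r ^ 5 * (1 + k) ^ 2 = k * (1 - k) ^ 2 := by
  have hr_mul : r ^ 2 * d * (1 + k) = b * (1 - k) := by
    refine mul_left_cancel₀ (mul_ne_zero hb (pow_ne_zero 2 hc)) ?_
    linear_combination b * difference_relation - c * r * sum_relation
       - (b * e ^ 2 + c * d * r * (1 + k)) * hr
  have hk_mul : x * r * b ^ 2 = k * d ^ 2 := by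
    refine mul_left_cancel₀ hc ?_
    linear_combination d * hk - x * b * hr
  refine mul_left_cancel₀ (pow_ne_zero 2 hd) ?_
  linear_combination x * r * (r ^ 2 * d * (1 + k) + b * (1 - k)) * hr_mul + (1 - k) ^ 2 * hk_mul

theorem pow_mul_parameter_eq {a b c d e k l : A} (ha : a ≠ 0) (hb : b ≠ 0) (hd : d ≠ 0)
    (hl : c * d = a * b * l)
    (sum_relation : b ^ 2 * e ^ 2 = a * d ^ 2 * (1 + k))
    (difference_relation : a * d * e ^ 2 = b * c ^ 2 * (1 - k)) :
    a ^ 3 * d * (l ^ 2 * (1 + k) ^ 2 * (1 - k)) = b * e ^ 6 := by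
  have product : a * d * (c * d) ^ 2 * ((1 + k) ^ 2 * (1 - k)) = b ^ 3 * e ^ 6 := by
    refine mul_left_cancel₀ (mul_ne_zero (mul_ne_zero ha hb) hd) ?_
    linear_combination
      -(b * c ^ 2 * (1 - k) * (a * d ^ 2 * (1 + k) + b ^ 2 * e ^ 2)) * sum_relation -
        (b ^ 2 * e ^ 2) ^ 2 * difference_relation
  refine mul_left_cancel₀ (pow_ne_zero 2 hb) ?_
  linear_combination product - a * d * ((1 + k) ^ 2 * (1 - k)) * (c * d + a * b * l) * hl

variable {R : Type*} [CommRing R] [Algebra R A] (D : Derivation R A A)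

theorem derivation_eq_zero_of_pow_mul {e t : A} {n : ℕ} (he : e ≠ 0) (hDe : D e = 0)
    (h : D (e ^ n * t) = 0) : D t = 0 := by
  simpa [Derivation.leibniz, Derivation.leibniz_pow, hDe, he] using h

variable [CharP A 5]

theorem derivation_parameter {x k r : A} (hx : D x = x) (hk : 1 - k ≠ 0)
    (h : x * r ^ 5 * (1 + k) ^ 2 = k * (1 - k) ^ 2) :
    D k * (1 + k - k ^ 2) = k * (1 - k ^ 2) := by
  have five_eq_zero : (5 : A) = 0 := CharP.ofNat_eq_zero A 5
  have derivative := congrArg D h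
  simp only [Derivation.leibniz, Derivation.leibniz_pow, smul_eq_mul, nsmul_eq_mul, map_add,
    map_sub, Derivation.map_one_eq_zero, hx, Nat.cast_ofNat, five_eq_zero] at derivative
  refine mul_left_cancel₀ hk ?_
  linear_combination -(1 + k) * derivative + (1 + k + 2 * D k) * h +
    (1 - k) * k * D k * five_eq_zero

theorem derivation_antiderivative {k l : A} (hk : k ≠ 0) (hne : 1 + k - k ^ 2 ≠ 0)
    (hlk : D (l * k) = l * k) (hDk : D k * (1 + k - k ^ 2) = k * (1 - k ^ 2)) :
    D (l ^ 2 * (2 - 2 * k - k ^ 3)) - 2 * (l ^ 2 * (2 - 2 * k - k ^ 3)) =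
      l ^ 2 * (1 + k) ^ 2 * (1 - k) := by
  have five_eq_zero : (5 : A) = 0 := CharP.ofNat_eq_zero A 5
  have hDl : D l * (1 + k - k ^ 2) = l * k := by
    refine mul_left_cancel₀ hk ?_
    rw [Derivation.leibniz, smul_eq_mul, smul_eq_mul] at hlk
    linear_combination (1 + k - k ^ 2) * hlk - l * hDk
  refine mul_left_cancel₀ hne ?_
  have derivative : D (l ^ 2 * (2 - 2 * k - k ^ 3)) =
      2 * l * D l * (2 - 2 * k - k ^ 3) - l ^ 2 * (2 + 3 * k ^ 2) * D k := by
    have map_two : D 2 = 0 := mod_cast D.map_natCast 2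
    simp only [Derivation.leibniz, Derivation.leibniz_pow, map_two, map_sub, smul_eq_mul,
      nsmul_eq_mul]
    push_cast
    ring
  rw [derivative]
  linear_combination 2 * l * (2 - 2 * k - k ^ 3) * hDl - l ^ 2 * (2 + 3 * k ^ 2) * hDk +
    l ^ 2 * (k ^ 2 - 1) * five_eq_zero

end RamanujanParameter

section PowerSeriesModFive

variable {R : Type*} [CommRing R]

theorem isUnit_map_intCast {f : ℤ⟦X⟧} (hf : constantCoeff f = 1) :
    IsUnit (map (Int.castRingHom R) f) :=
  (isUnit_of_constantCoeff_eq_one hf).map _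

variable [IsDomain R] [CharP R 5] {a b c d e : R⟦X⟧}

theorem exists_mul_eulerDerivation_sub_eq (ha : IsUnit a) (hb : IsUnit b) (hc : IsUnit c)
    (hd : IsUnit d) (sum_relation : b ^ 2 * c * e ^ 2 = a * d * (c * d + X * (a * b)))
    (difference_relation : a * d ^ 2 * e ^ 2 = b * c * (c * d - X * (a * b))) :
    ∃ G, a ^ 3 * d * (eulerDerivation R G - 2 * G) = b * e ^ 6 := by
  have charP_powerSeries : CharP R⟦X⟧ 5 := charP_of_injective_ringHom C_injective 5
  obtain ⟨κ, hκ⟩ : c * d ∣ a * b := (hc.mul hd).dvd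
  obtain ⟨l, hl⟩ : a * b ∣ c * d := (ha.mul hb).dvd
  obtain ⟨r, hr⟩ : b * c ∣ a * d := (hb.mul hc).dvd
  have hlκ : l * κ = 1 := by
    refine mul_left_cancel₀ (hc.mul hd).ne_zero ?_
    linear_combination -hl - l * hκ
  have ne_zero_of_constantCoeff {f : R⟦X⟧} (hf : constantCoeff f = 1) : f ≠ 0 :=
    (isUnit_of_constantCoeff_eq_one hf).ne_zero
  have sum_parameter : b ^ 2 * e ^ 2 = a * d ^ 2 * (1 + X * κ) := by
    refine mul_left_cancel₀ hc.ne_zero ?_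
    linear_combination sum_relation + a * d * X * hκ
  have difference_parameter : a * d * e ^ 2 = b * c ^ 2 * (1 - X * κ) := by
    refine mul_left_cancel₀ hd.ne_zero ?_
    linear_combination difference_relation - b * c * X * hκ
  have relation := ramanujan_parameter_relation hb.ne_zero hc.ne_zero hd.ne_zero
    (x := X) (k := X * κ) (by linear_combination X * hκ) hr sum_parameter difference_parameter
  have hDκ := derivation_parameter (eulerDerivation R) eulerDerivation_X
    (ne_zero_of_constantCoeff (by simp)) relation
  have antiderivative := derivation_antiderivative (eulerDerivation R) (l := l)
    (mul_ne_zero X_ne_zero (right_ne_zero_of_mul_eq_one hlκ))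
    (ne_zero_of_constantCoeff (by simp))
    (by rw [mul_left_comm, hlκ, mul_one, eulerDerivation_X]) hDκ
  refine ⟨l ^ 2 * (2 - 2 * (X * κ) - (X * κ) ^ 3), ?_⟩
  rw [antiderivative]
  exact pow_mul_parameter_eq ha.ne_zero hb.ne_zero hd.ne_zero hl sum_parameter
    difference_parameter

theorem exists_eulerDerivation_sub_eq {J U : R⟦X⟧} (ha : IsUnit a) (hb : IsUnit b)
    (hc : IsUnit c) (hd : IsUnit d) (he : IsUnit e) (hDe : eulerDerivation R e = 0)
    (hDJ : eulerDerivation R J = 0)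
    (sum_relation : b ^ 2 * c * e ^ 2 = a * d * (c * d + X * (a * b)))
    (difference_relation : a * d ^ 2 * e ^ 2 = b * c * (c * d - X * (a * b)))
    (hU : U * (a ^ 3 * d * e) = b * J) : ∃ G, eulerDerivation R G - 2 * G = U := by
  obtain ⟨G, hG⟩ := exists_mul_eulerDerivation_sub_eq ha hb hc hd sum_relation
    difference_relation
  obtain ⟨t, ht⟩ : e ^ 7 ∣ J := (he.pow 7).dvd
  have hDt := derivation_eq_zero_of_pow_mul (eulerDerivation R) he.ne_zero hDe (ht ▸ hDJ)
  refine ⟨t * G, mul_right_cancel₀ (((ha.pow 3).mul hd).mul he).ne_zero ?_⟩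
  rw [hU, ht, Derivation.leibniz, hDt, smul_zero, add_zero, smul_eq_mul]
  linear_combination t * e * hG

theorem eulerDerivation_map_qPoch_five_ten :
    eulerDerivation R (map (Int.castRingHom R) (qPoch (X ^ 5) (X ^ 10))) = 0 := by
  have hD_five := eulerDerivation_map_eulerE (R := R) 5 (by norm_num) one_pos
  have hD_ten := eulerDerivation_map_eulerE (R := R) 5 (by norm_num) two_pos
  rw [mul_one, eulerE_five, mul_comm, ← pow_one (eulerE 10), map_mul, map_pow] at hD_five
  exact derivation_eq_zero_of_pow_mul _
    (isUnit_map_intCast (constantCoeff_eulerE (by norm_num))).ne_zero hD_ten hD_five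

theorem coeff_map_oddPart_appellLerchGen (n : ℕ) :
    coeff (5 * n + 2) (map (Int.castRingHom R) (oddPart (appellLerchGen 1 10))) = 0 := by
  have isUnit_tenPair {i : ℕ} (hi : 0 < i) (hi' : i < 10) :=
    isUnit_map_intCast (R := R) (constantCoeff_tenPair hi hi')
  have sum_relation := congrArg (map (Int.castRingHom R)) tenPair_two_sq_mul
  have difference_relation := congrArg (map (Int.castRingHom R)) tenPair_one_mul_four_sq
  have odd_part := congrArg (map (Int.castRingHom R)) oddPart_appellLerchGen_mul_tenPair
  simp only [map_mul, map_add, map_sub, map_pow, map_X]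
    at sum_relation difference_relation odd_part
  obtain ⟨G, hG⟩ := exists_eulerDerivation_sub_eq (isUnit_tenPair one_pos (by norm_num))
    (isUnit_tenPair two_pos (by norm_num)) (isUnit_tenPair (i := 3) (by norm_num) (by norm_num))
    (isUnit_tenPair (i := 4) (by norm_num) (by norm_num))
    (isUnit_map_intCast constantCoeff_qPoch_five_ten) eulerDerivation_map_qPoch_five_ten
    (eulerDerivation_map_eulerE 5 (by norm_num) two_pos) sum_relation difference_relation
    odd_part
  exact coeff_eq_zero_of_eulerDerivation_sub_eq 5 (m := 2) (mod_cast hG) n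

end PowerSeriesModFive

theorem appellLerchA_modEq_zero (n : ℕ) : appellLerchA 1 10 (10 * n + 5) ≡ 0 [ZMOD 5] := by
  have : Fact (Nat.Prime 5) := ⟨Nat.prime_five⟩
  have coeff_eq_zero := coeff_map_oddPart_appellLerchGen (R := ZMod 5) n
  rw [coeff_map, oddPart, coeff_mk, show 2 * (5 * n + 2) + 1 = 10 * n + 5 by ring]
    at coeff_eq_zero
  exact (ZMod.intCast_eq_intCast_iff _ _ 5).mp (by simpa [appellLerchA] using coeff_eq_zero)

end

theorem mainTheorem4 :
    (∀ n : ℕ, appellLerchA 1 10 (10 * n + 5) ≡ 0 [ZMOD 5]) ∧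
    2 * PowerSeries.mk (fun n : ℕ => appellLerchA 1 10 (2 * n + 1)) =
      eulerE 1 ^ 2 * Ring.inverse (eulerE 5) +
      6 * X * (eulerE 2 * eulerE 10 ^ 3) * Ring.inverse (eulerE 1 * eulerE 5 ^ 2) +
      eulerE 2 ^ 2 * Ring.inverse (eulerE 1 ^ 2 * eulerE 5) *
        (thetaPhi (X ^ 2) * thetaPhi (X ^ 10) -
          4 * X ^ 3 * thetaPsi (X ^ 4) * thetaPsi (X ^ 20)) :=
  ⟨appellLerchA_modEq_zero, two_mul_oddPart_appellLerchGen⟩
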